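/- Let $A=(a_{ij})$ be an integral $m\times n$ matrix with rows $\alpha_1,\dots,\alpha_m$, all nonzero, and let $v=(v_1,\dots,v_m)\in\mathbb{Z}^m$. Let $\mathcal{A}=\{H_1,\dots,H_m\}$ with $H_i=\{x\in\mathbb{R}^n:\alpha_i x=v_i\}$, and for a positive integer $q$ let $H_{i,q}=\{x\in(\mathbb{Z}/q\mathbb{Z})^n:\alpha_i x\equiv v_i \pmod q\}$. For $J\subseteq[m]$ let $A_J$, $v_J$ consist of the rows indexed by $J$, put $r(J)=\operatorname{rank}A_J$, $\bar r(J)=\operatorname{rank}[A_J,v_J]$ and $s=\operatorname{rank}A$, and let $0<d_{J,1}\mid\cdots\mid d_{J,r(J)}$ and $0<\bar d_{J,1}\mid\cdots\mid\bar d_{J,\bar r(J)}$ be the invariant factors of $A_J$ and of $[A_J,v_J]$; if $\bar r(J)=r(J)+1$ put $d_{J,\bar r(J)}=0$. Let $$\rho_C=\operatorname{lcm}\{d_{J,r(J)}:\bar r(J)=r(J)\},\qquad q_0=\max\{\bar d_{J,\bar r(J)}:\bar r(J)=r(J)+1\},$$ where $J=\emptyset$ contributes $1$ to the lcm and the maximum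 of the empty set is $0$. For a positive integer $q$ let $\tilde d_J(q)=\prod_{j=1}^{r(J)}\gcd(d_{J,j},q)$ if $\gcd(q,d_{J,j})=\gcd(q,\bar d_{J,j})$ for all $1\le j\le\bar r(J)$, and $\tilde d_J(q)=0$ otherwise. For $0\le j\le s$ let $$\beta_j(q)=(-1)^j\sum_{J\subseteq[m],\ \bar r(J)=r(J)=j}(-1)^{\#J}\tilde d_J(q)$$ be the unsigned coefficient of $q^{n-j}$ in the characteristic quasi-polynomial $\sum_{\bar r(J)=r(J)}(-1)^{\#J}\tilde d_J(q)q^{n-r(J)}$, and for $1\le a\le\rho_C$ let $\gamma_j(a)$ be $(-1)^j$ times the coefficient of $t^{n-j}$ in its $a$-th constituent $f_a(t)=\sum_{\bar r(J)=r(J)}(-1)^{\#J}\tilde d_J(a)t^{n-r(J)}$. Call a set $J\subseteq[m]$ central if $\bigcap_{i\in J}H_i\neq\emptyset$, a circuit if it is central with $r(J)<\#J$ and $r(K)=\#K$ for every $K\subsetneq J$, and a broken circuit if it is a circuit with its largest element removed; let $w_j(\mathcal{A})$ be the number of central $j$-element subsets of $[m]$ that contain no broken circuit. Positive integers $p,q$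 are combinatorially equivalent if, for every $J$ with $\bar r(J)=r(J)$, $\bigcap_{j\in J}H_{j,p}\ne\emptyset\iff\bigcap_{j\in J}H_{j,q}\neq\emptyset$. Let $q>q_0$ and $1\le a,b\le\rho_C$ be integers such that $\gcd(a,\rho_C)\mid\gcd(b,\rho_C)=\gcd(q,\rho_C)$, such that $\gcd(a,\rho_C)$ and $\gcd(b,\rho_C)$ are combinatorially equivalent, and such that for every $J\subseteq[m]$ with $\bar r(J)=r(J)$ the reduction of $v_J$ mod $q$ lies in the column space of $A_J$ over $\mathbb{Z}/q\mathbb{Z}$. Then $$0<w_j(\mathcal{A})=\gamma_j(1)\le\gamma_j(a)\le\gamma_j(b)=\beta_j(q)\qquad(0\le j\le s).$$ Moreover, if $v=0$, the same conclusion holds for all integers $q\ge1$ and $1\le a,b\le\rho_C$ with $\gcd(a,\rho_C)\mid\gcd(b,\rho_C)=\gcd(q,\rho_C)$, without the equivalence and solvability conditions. -/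

import Mathlib

namespace IntegralArrangement

/-- Two integral matrices are equivalent if they differ by unimodular row and column operations. -/
def UnimodEquiv {p k : ℕ} (M N : Matrix (Fin p) (Fin k) ℤ) : Prop :=
  ∃ (P : Matrix (Fin p) (Fin p) ℤ) (Q : Matrix (Fin k) (Fin k) ℤ),
    IsUnit P.det ∧ IsUnit Q.det ∧ P * M * Q = N

theorem UnimodEquiv.trans {p k : ℕ} {M N K : Matrix (Fin p) (Fin k) ℤ}
    (h₁ : UnimodEquiv M N) (h₂ : UnimodEquiv N K) : UnimodEquiv M K := by
  obtain ⟨P, Q, hP, hQ, rfl⟩ := h₁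
  obtain ⟨P', Q', hP', hQ', rfl⟩ := h₂
  refine ⟨P' * P, Q * Q', ?_, ?_, ?_⟩
  · rw [Matrix.det_mul]; exact hP'.mul hP
  · rw [Matrix.det_mul]; exact hQ.mul hQ'
  · simp only [Matrix.mul_assoc]

theorem UnimodEquiv.left {p k : ℕ} (M : Matrix (Fin p) (Fin k) ℤ) {P : Matrix (Fin p) (Fin p) ℤ}
    (hP : IsUnit P.det) : UnimodEquiv M (P * M) :=
  ⟨P, 1, hP, by simp, by simp⟩

theorem UnimodEquiv.right {p k : ℕ} (M : Matrix (Fin p) (Fin k) ℤ) {Q : Matrix (Fin k) (Fin k) ℤ}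
    (hQ : IsUnit Q.det) : UnimodEquiv M (M * Q) :=
  ⟨1, Q, by simp, hQ, by simp⟩

theorem UnimodEquiv.transpose {p k : ℕ} {M N : Matrix (Fin p) (Fin k) ℤ}
    (h : UnimodEquiv M N) : UnimodEquiv M.transpose N.transpose := by
  obtain ⟨P, Q, hP, hQ, rfl⟩ := h
  exact ⟨Q.transpose, P.transpose, by simpa, by simpa, by
    simp only [Matrix.transpose_mul, Matrix.mul_assoc]⟩

/-- Subtracting multiples of row `0` from the other rows. -/
theorem UnimodEquiv.clearCol {p k : ℕ} (M : Matrix (Fin (p + 1)) (Fin k) ℤ) (c : Fin p → ℤ) :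
    UnimodEquiv M (Matrix.of fun i j => Fin.cases (M 0 j) (fun i' => M i'.succ j - c i' * M 0 j) i) := by
  let P : Matrix (Fin (p + 1)) (Fin (p + 1)) ℤ := Matrix.of fun i j =>
    Fin.cases (Fin.cases 1 (fun _ => 0) j)
      (fun i' => Fin.cases (-c i') (fun j' => (1 : Matrix (Fin p) (Fin p) ℤ) i' j') j) i
  have hP : P.det = 1 := by
    rw [Matrix.det_succ_row_zero, Fin.sum_univ_succ]
    have : P.submatrix Fin.succ Fin.succ = 1 := by ext i j; simp [P]
    simp [P, this]
  convert UnimodEquiv.left M (P := P) (by simp [hP]) using 1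
  ext i j
  refine Fin.cases ?_ (fun i' => ?_) i
  · simp [P, Matrix.mul_apply, Fin.sum_univ_succ]
  · simp [P, Matrix.mul_apply, Fin.sum_univ_succ, Matrix.one_apply]
    ring

theorem UnimodEquiv.dvd_col {p k : ℕ} {M N : Matrix (Fin (p + 1)) (Fin (k + 1)) ℤ} {g : ℕ}
    (hg : 0 < g) (hmin : ∀ N, UnimodEquiv M N → ∀ i j, N i j ≠ 0 → g ≤ (N i j).natAbs)
    (h : UnimodEquiv M N) (h0 : N 0 0 = g) (i : Fin p) : (g : ℤ) ∣ N i.succ 0 := by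
  have key := hmin _ (h.trans (UnimodEquiv.clearCol N fun i => N i.succ 0 / g)) i.succ 0
  simp only [Matrix.of_apply, Fin.cases_succ, h0] at key
  have e : N i.succ 0 - N i.succ 0 / g * g = N i.succ 0 % g := by
    rw [Int.emod_def]; ring
  rw [e] at key
  by_contra hne
  have h1 := key (fun h => hne (Int.dvd_of_emod_eq_zero h))
  have h2 := Int.emod_lt_of_pos (N i.succ 0) (by exact_mod_cast hg : (0 : ℤ) < g)
  have h3 := Int.emod_nonneg (N i.succ 0) (by positivity : (g : ℤ) ≠ 0)
  omega

theorem UnimodEquiv.dvd_row {p k : ℕ} {M N : Matrix (Fin (p + 1)) (Fin (k + 1)) ℤ} {g : ℕ}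
    (hg : 0 < g) (hmin : ∀ N, UnimodEquiv M N → ∀ i j, N i j ≠ 0 → g ≤ (N i j).natAbs)
    (h : UnimodEquiv M N) (h0 : N 0 0 = g) (j : Fin k) : (g : ℤ) ∣ N 0 j.succ :=
  UnimodEquiv.dvd_col (M := M.transpose) (N := N.transpose) hg
    (fun K hK i j hne => hmin K.transpose (by simpa using hK.transpose) j i hne)
    h.transpose h0 j

theorem UnimodEquiv.exists_block {p k : ℕ} (M : Matrix (Fin (p + 1)) (Fin (k + 1)) ℤ) :
    ∃ (g : ℕ) (K : Matrix (Fin p) (Fin k) ℤ), UnimodEquiv M (Matrix.of fun i j =>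
      Fin.cases (Fin.cases (g : ℤ) (fun _ => 0) j)
        (fun i' => Fin.cases 0 (fun j' => (g : ℤ) * K i' j') j) i) := by
  classical
  by_cases hM : M = 0
  · refine ⟨0, 0, 1, 1, by simp, by simp, ?_⟩
    ext i j
    refine Fin.cases ?_ (fun i' => ?_) i <;> refine Fin.cases ?_ (fun j' => ?_) j <;> simp [hM]
  have hex : ∃ g : ℕ, 0 < g ∧ ∃ N, UnimodEquiv M N ∧ ∃ i j, (N i j).natAbs = g := by
    obtain ⟨i, j, hij⟩ : ∃ i j, M i j ≠ 0 := by
      by_contra! h; exact hM (by ext i j; simpa using h i j)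
    exact ⟨_, Int.natAbs_pos.2 hij, M, ⟨1, 1, by simp, by simp, by simp⟩, i, j, rfl⟩
  obtain ⟨hg, N, hN, i, j, hij⟩ := Nat.find_spec hex
  have hmin : ∀ N, UnimodEquiv M N → ∀ i j, N i j ≠ 0 → Nat.find hex ≤ (N i j).natAbs :=
    fun N hN i j hne => Nat.find_min' hex ⟨Int.natAbs_pos.2 hne, N, hN, i, j, rfl⟩
  generalize Nat.find hex = g at hg hij hmin
  -- move the minimal entry to the corner
  obtain ⟨N₁, hN₁, h₁⟩ : ∃ N₁, UnimodEquiv M N₁ ∧ N₁ 0 0 = g := by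
    have hs : UnimodEquiv M (N.submatrix (Equiv.swap 0 i) (Equiv.swap 0 j)) := by
      refine hN.trans ⟨(Equiv.swap 0 i).permMatrix ℤ, (Equiv.swap 0 j).permMatrix ℤ, ?_, ?_, ?_⟩
      · rw [Matrix.det_permutation]; exact Units.isUnit _
      · rw [Matrix.det_permutation]; exact Units.isUnit _
      · ext x y
        simp [Equiv.Perm.permMatrix, PEquiv.toMatrix_toPEquiv_mul, PEquiv.mul_toMatrix_toPEquiv]
    rcases Int.natAbs_eq (N i j) with h | h
    · exact ⟨_, hs, by simpa [hij] using h⟩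
    · refine ⟨_, hs.trans (UnimodEquiv.left _ (P := -1) ?_), ?_⟩
      · rw [Matrix.det_neg]; simp
      · simp; rw [h, hij]; simp
  -- clear the first column, then the first row
  have hd₁ := UnimodEquiv.dvd_col hg hmin hN₁ h₁
  obtain ⟨N₂, hN₂, h₂, hc₂⟩ : ∃ N₂, UnimodEquiv M N₂ ∧ N₂ 0 0 = g ∧ ∀ i : Fin p, N₂ i.succ 0 = 0 := by
    refine ⟨_, hN₁.trans (UnimodEquiv.clearCol N₁ fun i => N₁ i.succ 0 / g), by simpa using h₁, ?_⟩
    intro i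
    simp [h₁, Int.ediv_mul_cancel (hd₁ i)]
  have hd₂ := UnimodEquiv.dvd_row hg hmin hN₂ h₂
  obtain ⟨N₃, hN₃, h₃, hc₃, hr₃⟩ : ∃ N₃, UnimodEquiv M N₃ ∧ N₃ 0 0 = g ∧
      (∀ i : Fin p, N₃ i.succ 0 = 0) ∧ ∀ j : Fin k, N₃ 0 j.succ = 0 := by
    refine ⟨_, hN₂.trans (by
      simpa using (UnimodEquiv.clearCol N₂.transpose fun j => N₂ 0 j.succ / g).transpose),
      by simpa using h₂, ?_, ?_⟩
    · intro i; simpa using hc₂ i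
    · intro j; simp [h₂, Int.ediv_mul_cancel (hd₂ j)]
  have hdiv : ∀ (i : Fin p) (j : Fin k), (g : ℤ) ∣ N₃ i.succ j.succ := by
    intro i j
    have ht : UnimodEquiv M (Matrix.transvection (0 : Fin (p + 1)) i.succ (1 : ℤ) * N₃) :=
      hN₃.trans (UnimodEquiv.left _ (by
        rw [Matrix.det_transvection_of_ne _ _ (Fin.succ_ne_zero i).symm]; simp))
    have := UnimodEquiv.dvd_row hg hmin ht (by simp [h₃, hc₃]) j
    simpa [hr₃] using this
  choose K hK using hdiv
  refine ⟨g, Matrix.of K, ?_⟩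
  convert hN₃ using 1
  ext i j
  refine Fin.cases ?_ (fun i' => ?_) i <;> refine Fin.cases ?_ (fun j' => ?_) j <;>
    simp [h₃, hc₃, hr₃, hK]

/-- `d 1 ∣ d 2 ∣ ⋯` are the diagonal entries of a Smith normal form `P * M * Q` of `M`, with `P`, `Q`
unimodular. The sequence is padded by `d 0 = 1` and by `d j = 0` beyond the size of `M`; by
divisibility its nonzero entries come first, so `d j ≠ 0` exactly for `j ≤ rank M`. -/
def IsSmithForm {p k : ℕ} (M : Matrix (Fin p) (Fin k) ℤ) (d : ℕ → ℕ) : Prop :=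
  d 0 = 1 ∧ (∀ j, d j ∣ d (j + 1)) ∧ (∀ j, min p k < j → d j = 0) ∧
    UnimodEquiv M
      (Matrix.of fun (i : Fin p) (j : Fin k) => if (i : ℕ) = (j : ℕ) then (d (i + 1) : ℤ) else 0)

theorem exists_isSmithForm : ∀ {p k : ℕ} (M : Matrix (Fin p) (Fin k) ℤ), ∃ d, IsSmithForm M d
  | 0, k, M => ⟨fun j => if j = 0 then 1 else 0, by simp, fun j => by
      by_cases h : j = 0 <;> simp [h], fun j hj => by simp; omega, 1, 1, by simp, by simp, by
      ext i; exact i.elim0⟩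
  | p + 1, 0, M => ⟨fun j => if j = 0 then 1 else 0, by simp, fun j => by
      by_cases h : j = 0 <;> simp [h], fun j hj => by simp; omega, 1, 1, by simp, by simp, by
      ext i j; exact j.elim0⟩
  | p + 1, k + 1, M => by
    obtain ⟨g, K, hK⟩ := UnimodEquiv.exists_block M
    obtain ⟨d, h0, hd, hz, P, Q, hP, hQ, hPQ⟩ := exists_isSmithForm K
    refine ⟨fun j => Nat.casesOn j 1 fun i => g * d i, rfl, ?_, ?_, ?_⟩
    · rintro (_ | j)
      · simp
      · exact Nat.mul_dvd_mul_left g (hd j)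
    · rintro (_ | j) hj
      · omega
      · simp [hz j (by omega)]
    let bord : ∀ {t : ℕ}, Matrix (Fin t) (Fin t) ℤ → Matrix (Fin (t + 1)) (Fin (t + 1)) ℤ :=
      fun R => Matrix.of fun i j =>
        Fin.cases (Fin.cases 1 (fun _ => 0) j) (fun i' => Fin.cases 0 (fun j' => R i' j') j) i
    have hdet : ∀ {t : ℕ} (R : Matrix (Fin t) (Fin t) ℤ), (bord R).det = R.det := by
      intro t R
      rw [Matrix.det_succ_row_zero, Fin.sum_univ_succ]
      have : (bord R).submatrix Fin.succ (Fin.succAbove 0) = R := by ext i j; simp [bord]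
      rw [this]
      simp [bord]
    obtain ⟨P', Q', hP', hQ', h⟩ := hK.trans ⟨bord P, bord Q, by rwa [hdet], by rwa [hdet], rfl⟩
    refine ⟨P', Q', hP', hQ', h.trans ?_⟩
    have hPQ' : ∀ i j, ∑ y, (∑ x, P i x * K x y) * Q y j =
        if (i : ℕ) = (j : ℕ) then (d (i + 1) : ℤ) else 0 := by
      intro i j
      simpa [Matrix.mul_apply] using congrFun (congrFun hPQ i) j
    ext i j
    refine Fin.cases ?_ (fun i' => ?_) i <;> refine Fin.cases ?_ (fun j' => ?_) j
    · simp [bord, Matrix.mul_apply, Fin.sum_univ_succ, h0]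
    · simp [bord, Matrix.mul_apply, Fin.sum_univ_succ]
    · simp [bord, Matrix.mul_apply, Fin.sum_univ_succ]
    · simp only [bord, Matrix.mul_apply, Fin.sum_univ_succ, Matrix.of_apply, Fin.cases_succ,
        Fin.cases_zero, mul_zero, zero_mul, zero_add, Finset.sum_const_zero,
        Fin.val_succ, add_left_inj]
      have := hPQ' i' j'
      calc _ = (g : ℤ) * ∑ y, (∑ x, P i' x * K x y) * Q y j' := by
            rw [Finset.mul_sum]
            refine Finset.sum_congr rfl fun y _ => ?_
            rw [← mul_assoc, Finset.mul_sum]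
            congr 1
            refine Finset.sum_congr rfl fun x _ => by ring
        _ = _ := by
            rw [this]; split_ifs <;> simp

/-- The `j`-th invariant factor `d_j(M)` (for `1 ≤ j ≤ rank M`); it is `1` for `j = 0` and `0` for
`j > rank M`. -/
noncomputable def invFactor {p k : ℕ} (M : Matrix (Fin p) (Fin k) ℤ) (j : ℕ) : ℕ :=
  Classical.choose (exists_isSmithForm M) j

theorem invFactor_spec {p k : ℕ} (M : Matrix (Fin p) (Fin k) ℤ) : IsSmithForm M (invFactor M) :=
  Classical.choose_spec (exists_isSmithForm M)

/-- The rank of an integral matrix. -/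
noncomputable def intRank {p k : ℕ} (M : Matrix (Fin p) (Fin k) ℤ) : ℕ :=
  (M.map (Int.cast : ℤ → ℝ)).rank

section Arrangement

variable {m n : ℕ} (A : Matrix (Fin m) (Fin n) ℤ) (v : Fin m → ℤ)

/-- The submatrix `A_J` of the rows indexed by `J`. -/
def rowsOf (J : Finset (Fin m)) : Matrix (Fin J.card) (Fin n) ℤ :=
  A.submatrix (J.orderEmbOfFin rfl) id

/-- The augmented submatrix `[A_J, v_J]`. -/
def augRowsOf (J : Finset (Fin m)) : Matrix (Fin J.card) (Fin (n + 1)) ℤ :=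
  Matrix.of fun i => Fin.snoc (rowsOf A J i) (v (J.orderEmbOfFin rfl i))

/-- `r(J) = rank A_J`. -/
noncomputable def rk (J : Finset (Fin m)) : ℕ := intRank (rowsOf A J)

/-- `r̄(J) = rank [A_J, v_J]`. -/
noncomputable def augRk (J : Finset (Fin m)) : ℕ := intRank (augRowsOf A v J)

/-- The invariant factors `d_{J,j}` of `A_J` (so `d_{J,j} = 0` for `j > r(J)`). -/
noncomputable def dFac (J : Finset (Fin m)) (j : ℕ) : ℕ := invFactor (rowsOf A J) j

/-- The invariant factors `d̄_{J,j}` of `[A_J, v_J]`. -/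
noncomputable def augDFac (J : Finset (Fin m)) (j : ℕ) : ℕ := invFactor (augRowsOf A v J) j

/-- The index sets `J` with `r̄(J) = r(J)`. -/
noncomputable def consistentSets : Finset (Finset (Fin m)) :=
  Finset.univ.filter fun J => augRk A v J = rk A J

/-- The lcm period `ρ`: the lcm of the maximal invariant factors `d_{J,r(J)}` over the `J` with
`r̄(J) = r(J)` (the empty set `J` contributes `1`). -/
noncomputable def lcmPeriod : ℕ :=
  (consistentSets A v).lcm fun J => dFac A J (rk A J)

/-- `q₀`: the maximum of `d̄_{J,r̄(J)}` over the `J` with `r̄(J) = r(J) + 1`, and `0` if there are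
none. -/
noncomputable def qZero : ℕ :=
  (Finset.univ.filter fun J => augRk A v J = rk A J + 1).sup fun J => augDFac A v J (augRk A v J)

open Classical in
/-- `d̃_J(q)`. -/
noncomputable def dTilde (J : Finset (Fin m)) (q : ℕ) : ℕ :=
  if ∀ j ∈ Finset.Icc 1 (augRk A v J), Nat.gcd q (dFac A J j) = Nat.gcd q (augDFac A v J j) then
    ∏ j ∈ Finset.Icc 1 (rk A J), Nat.gcd (dFac A J j) q
  else 0

/-- The unsigned coefficient `β_j(q)` of `q ^ (n - j)` in the characteristic quasi-polynomial
`∑_{J : r̄(J) = r(J)} (-1) ^ #J * d̃_J(q) * q ^ (n - r(J))`. -/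
noncomputable def betaCoeff (j q : ℕ) : ℤ :=
  (-1) ^ j * ∑ J ∈ consistentSets A v with rk A J = j, (-1) ^ J.card * (dTilde A v J q : ℤ)

/-- The `a`-th constituent `f_a(t) = ∑_{J : r̄(J) = r(J)} (-1) ^ #J * d̃_J(a) * t ^ (n - r(J))`
of the characteristic quasi-polynomial. -/
noncomputable def constituent (a : ℕ) : Polynomial ℤ :=
  ∑ J ∈ consistentSets A v,
    Polynomial.C ((-1) ^ J.card * (dTilde A v J a : ℤ)) * Polynomial.X ^ (n - rk A J)

/-- The unsigned coefficient `γ_j(a)` of `t ^ (n - j)` in the `a`-th constituent. -/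
noncomputable def gammaCoeff (j a : ℕ) : ℤ :=
  (-1) ^ j * (constituent A v a).coeff (n - j)

/-- The hyperplane `H_{i,q} = {x | α_i x = v_i}` in `(ℤ/q)^n`. -/
def hyperplaneMod (q : ℕ) (i : Fin m) : Set (Fin n → ZMod q) :=
  {x | ∑ k, (A i k : ZMod q) * x k = (v i : ZMod q)}

/-- `p` and `q` are combinatorially equivalent: for all `J` with `r̄(J) = r(J)`, the intersection of
the `H_{j,p}`, `j ∈ J`, is nonempty iff that of the `H_{j,q}` is. -/
def CombEquiv (p q : ℕ) : Prop :=
  ∀ J ∈ consistentSets A v,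
    (⋂ j ∈ J, hyperplaneMod A v p j).Nonempty ↔ (⋂ j ∈ J, hyperplaneMod A v q j).Nonempty

/-- `[c]_q ∈ Col_q(M)`: the reduction of `c` mod `q` lies in the `ℤ/q`-span of the columns of the
reduction of `M`. -/
def InColMod {p k : ℕ} (q : ℕ) (M : Matrix (Fin p) (Fin k) ℤ) (c : Fin p → ℤ) : Prop :=
  (fun i => (c i : ZMod q)) ∈
    Submodule.span (ZMod q) (Set.range (M.map (Int.cast : ℤ → ZMod q)).transpose)

/-- `[v_J]_q ∈ Col_q(A_J)` for all `J` with `r̄(J) = r(J)`. -/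
def SolvableMod (q : ℕ) : Prop :=
  ∀ J ∈ consistentSets A v, InColMod q (rowsOf A J) fun i => v (J.orderEmbOfFin rfl i)

/-- The real hyperplane `H_i = {x | α_i x = v_i}` in `ℝ^n`. -/
def hyperplane (i : Fin m) : Set (Fin n → ℝ) :=
  {x | ∑ k, (A i k : ℝ) * x k = (v i : ℝ)}

/-- `J` is central if the hyperplanes `H_i`, `i ∈ J`, have a common point. -/
def IsCentral (J : Finset (Fin m)) : Prop := (⋂ i ∈ J, hyperplane A v i).Nonempty

/-- A circuit: a minimal dependent central set, where a central `J` is dependent if the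
intersection of its hyperplanes has codimension `r(J) < #J`. -/
def IsCircuit (J : Finset (Fin m)) : Prop :=
  IsCentral A v J ∧ rk A J < J.card ∧ ∀ K ⊂ J, rk A K = K.card

/-- A broken circuit: a circuit with its largest element removed. -/
def IsBrokenCircuit (K : Finset (Fin m)) : Prop :=
  ∃ C : Finset (Fin m), IsCircuit A v C ∧ ∃ h : C.Nonempty, K = C.erase (C.max' h)

open Classical in
/-- `w_j`: the number of central `j`-subsets of the arrangement that contain no broken circuit. -/
noncomputable def nbcNumber (j : ℕ) : ℕ :=
  (Finset.univ.filter fun J : Finset (Fin m) =>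
    J.card = j ∧ IsCentral A v J ∧ ∀ K, IsBrokenCircuit A v K → ¬ K ⊆ J).card

end Arrangement

end IntegralArrangement

/-! Solvability of all consistent subsystems modulo `q` passes to every divisor of `gcd(q, ρ_C)`, in
particular to `gcd(a, ρ_C)`. It makes the gcd condition in `dTilde` hold (`gcd_dFac_dvd_augDFac`),
so all coefficients in the chain become values of one function, `gcdSum j g`, at `g = 1`, `gcd(a,
ρ_C)` and `gcd(b, ρ_C) = gcd(q, ρ_C)`. For `v = 0` the zero vector solves everything.

At `g = 1` all gcds are `1` and `gcdSum` is Whitney's alternating sum, hence counts central sets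
without broken circuits. It is positive because the basis chosen greedily from the largest index
down contains no broken circuit, nor does any subset of it.

It remains to show that `gcdSum j p ≤ gcdSum j q` when `p ∣ q`. Group the index sets by the flat `F`
they span. In `j` coordinates adapted to `F`, the product of the `gcd(d_{J,i}, g)` counts the `y ∈
(ℤ/g)^j` annihilated by the rows in `J` (Smith normal form). Interchanging sums gives, for each `y`,
the signed count of rank-`j` subsets of `F_y`, the rows of `F` vanishing at `y`. Times `(-1)^j` this
is nonnegative, since a sign-reversing involution leaves only independent sets, all of size `j`. An
embedding of `ℤ/p` in `ℤ/q` injects the points `y` without changing `F_y`, so the sum for `q` is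
that for `p` plus nonnegative terms. -/

namespace IntegralArrangement

/-! ### Smith normal form: divisibility and solution counts modulo `q` -/

/-- Fewer than `j + 1` integral linear forms have a primitive common zero supported on the first
`j + 1` coordinates. -/
theorem exists_primitive_mulVec_eq_zero {k k' j : ℕ} (hj : j < k) (Z : Matrix (Fin k') (Fin k) ℤ) :
    ∃ w : Fin k → ℤ, Finset.univ.gcd w = 1 ∧ (∀ l : Fin k, j < (l : ℕ) → w l = 0) ∧
      ∀ i : Fin k', (i : ℕ) < j → Z.mulVec w i = 0 := by
  classical
  -- The rows with index below `j` are padded to a square matrix by zeros; the last row is always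
  -- zero, so `N` is singular.
  let N : Matrix (Fin (j + 1)) (Fin (j + 1)) ℤ := Matrix.of fun i l =>
    if h : (i : ℕ) < j ∧ (i : ℕ) < k' then Z ⟨i, h.2⟩ (Fin.castLE hj l) else 0
  have hdet : N.det = 0 := Matrix.det_eq_zero_of_row_eq_zero (Fin.last j) fun l => by simp [N]
  obtain ⟨x, hx, hNx⟩ := Matrix.exists_mulVec_eq_zero_iff.2 hdet
  obtain ⟨y, hy, hy1⟩ := Finset.extract_gcd (s := Finset.univ) x ⟨0, Finset.mem_univ _⟩
  have hg : Finset.univ.gcd x ≠ 0 := fun h => hx (by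
    ext i; exact Finset.gcd_eq_zero_iff.1 h i (Finset.mem_univ i))
  let w : Fin k → ℤ := fun l => if h : (l : ℕ) < j + 1 then y ⟨l, h⟩ else 0
  have hwy : ∀ l : Fin (j + 1), w (Fin.castLE hj l) = y l := fun l => dif_pos l.isLt
  refine ⟨w, ?_, ?_, ?_⟩
  · have h1 : Finset.univ.gcd w ∣ 1 := by
      rw [← hy1]
      exact Finset.dvd_gcd fun l _ => hwy l ▸ Finset.gcd_dvd (Finset.mem_univ _)
    rw [← Finset.normalize_gcd]
    exact normalize_eq_one.2 (isUnit_of_dvd_one h1)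
  · intro l hl
    exact dif_neg (by omega)
  · intro i hi
    have h1 := congrFun hNx ⟨i, by omega⟩
    have h2 : Z.mulVec w i = ∑ l : Fin (j + 1), Z i (Fin.castLE hj l) * y l := by
      simp only [Matrix.mulVec, dotProduct]
      symm
      rw [← Finset.sum_subset (Finset.subset_univ (Finset.univ.map (Fin.castLEEmb hj)))]
      · rw [Finset.sum_map]
        exact Finset.sum_congr rfl fun l _ => by rw [Fin.castLEEmb_apply, hwy]
      · intro l _ hl
        have : ¬ (l : ℕ) < j + 1 := fun h => hl (Finset.mem_map.2 ⟨⟨l, h⟩, Finset.mem_univ _, rfl⟩)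
        simp only [w, dif_neg this, mul_zero]
    rw [h2]
    have h3 : Finset.univ.gcd x * ∑ l : Fin (j + 1), Z i (Fin.castLE hj l) * y l = 0 := by
      rw [← show N.mulVec x ⟨i, by omega⟩ = 0 from h1, Finset.mul_sum]
      simp only [Matrix.mulVec, dotProduct]
      refine Finset.sum_congr rfl fun l _ => ?_
      rw [hy l (Finset.mem_univ _)]
      simp [N, hi]; ring
    exact (mul_eq_zero.1 h3).resolve_left hg

theorem IsSmithForm.dvd_of_le {p k : ℕ} {M : Matrix (Fin p) (Fin k) ℤ} {d : ℕ → ℕ}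
    (h : IsSmithForm M d) {i j : ℕ} (hij : i ≤ j) : d i ∣ d j :=
  Nat.le_induction dvd_rfl (fun _ _ ih => ih.trans (h.2.1 _)) j hij

/-- Invariant factors of a matrix divide those of its products with other matrices; this holds
modulo `q`. -/
theorem IsSmithForm.gcd_dvd {p k p' k' : ℕ} {M : Matrix (Fin p) (Fin k) ℤ}
    {M' : Matrix (Fin p') (Fin k') ℤ} {d d' : ℕ → ℕ} (hd : IsSmithForm M d)
    (hd' : IsSmithForm M' d') (q : ℕ) (X : Matrix (Fin p) (Fin p') ℤ)
    (Y : Matrix (Fin k') (Fin k) ℤ) (R : Matrix (Fin p) (Fin k) ℤ)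
    (h : M = X * M' * Y + (q : ℤ) • R) (j : ℕ) : Nat.gcd q (d' j) ∣ d j := by
  classical
  rcases j with _ | j
  · simp [hd.1, hd'.1]
  by_cases hj : min p k < j + 1
  · simp [hd.2.2.1 _ hj]
  have hjp : j < p := by omega
  have hjk : j < k := by omega
  obtain ⟨P, Q, -, -, hD⟩ := hd.2.2.2
  obtain ⟨P', Q', hP', hQ', hD'⟩ := hd'.2.2.2
  set D := (Matrix.of fun (i : Fin p) (j : Fin k) => if (i : ℕ) = (j : ℕ) then (d (i + 1) : ℤ) else 0)
  set D' := (Matrix.of fun (i : Fin p') (j : Fin k') =>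
    if (i : ℕ) = (j : ℕ) then (d' (i + 1) : ℤ) else 0) with hD'def
  have hM' : M' = P'⁻¹ * D' * Q'⁻¹ := by
    rw [← hD', Matrix.mul_assoc P', Matrix.nonsing_inv_mul_cancel_left _ _ hP',
      Matrix.mul_nonsing_inv_cancel_right _ _ hQ']
  set Z := Q'⁻¹ * Y * Q with hZ
  have hDe : D = P * X * P'⁻¹ * (D' * Z) + (q : ℤ) • (P * R * Q) := by
    rw [← hD, h, hM', hZ]
    simp only [Matrix.mul_add, Matrix.add_mul, Matrix.mul_assoc, Matrix.mul_smul, Matrix.smul_mul]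
  -- Since `Z w` vanishes at indices below `j`, only diagonal entries of `D'` divisible by `d' (j +
  -- 1)` act on it, so `e` divides `D w`. As `w` lives on indices at most `j`, `e` divides `d (j +
  -- 1) * w`, and primitivity of `w` removes `w`.
  obtain ⟨w, hw1, hw0, hZw⟩ := exists_primitive_mulVec_eq_zero hjk Z
  set e := Nat.gcd q (d' (j + 1)) with he
  have heq : (e : ℤ) ∣ q := by exact_mod_cast Nat.gcd_dvd_left _ _
  have hDZ : ∀ i, (e : ℤ) ∣ (D' * Z).mulVec w i := by
    intro i
    rw [← Matrix.mulVec_mulVec]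
    simp only [Matrix.mulVec, dotProduct]
    refine Finset.dvd_sum fun l _ => ?_
    change (e : ℤ) ∣ D' i l * Z.mulVec w l
    by_cases hil : (i : ℕ) = l
    · by_cases hlj : (l : ℕ) < j
      · rw [hZw l hlj]; simp
      · refine Dvd.dvd.mul_right ?_ _
        simp only [hD'def, Matrix.of_apply, if_pos hil]
        exact_mod_cast (Nat.gcd_dvd_right _ _).trans (hd'.dvd_of_le (by omega))
    · simp [hD'def, hil]
  have hDw : ∀ i, (e : ℤ) ∣ D.mulVec w i := by
    intro i
    rw [hDe, Matrix.add_mulVec, ← Matrix.mulVec_mulVec, Matrix.smul_mulVec, Pi.add_apply]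
    refine dvd_add (Finset.dvd_sum (s := Finset.univ) fun l _ => (hDZ l).mul_left _) ?_
    exact heq.mul_right _
  have hdw : ∀ l, (e : ℤ) ∣ (d (j + 1) : ℤ) * w l := by
    intro l
    by_cases hl : j < (l : ℕ)
    · rw [hw0 l hl, mul_zero]; exact dvd_zero _
    have h1 := hDw ⟨l, by omega⟩
    have h2 : D.mulVec w ⟨l, by omega⟩ = d (l + 1) * w l := by
      simp only [Matrix.mulVec, dotProduct]
      rw [Finset.sum_eq_single l]
      · simp [D]
      · intro b _ hb
        have : (l : ℕ) ≠ b := fun h => hb (Fin.ext h.symm)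
        simp [D, this]
      · simp
    rw [h2] at h1
    have h3 : (d (l + 1) : ℤ) ∣ d (j + 1) := by exact_mod_cast hd.dvd_of_le (by omega)
    exact h1.trans (mul_dvd_mul_right h3 _)
  have h4 := Finset.dvd_gcd (s := Finset.univ) fun l _ => hdw l
  rw [Finset.gcd_mul_left, hw1, mul_one, dvd_normalize_iff] at h4
  exact_mod_cast h4

theorem card_mul_eq_zero (g d : ℕ) [NeZero g] :
    (Finset.univ.filter fun z : ZMod g => (d : ZMod g) * z = 0).card = Nat.gcd d g := by
  have h := IsCyclic.card_powMonoidHom_ker (Multiplicative (ZMod g)) d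
  rw [Nat.card_congr Multiplicative.toAdd, Nat.card_zmod, Nat.gcd_comm] at h
  rw [← h, ← Fintype.card_subtype, ← Nat.card_eq_fintype_card]
  refine Nat.card_congr (Equiv.subtypeEquiv Multiplicative.ofAdd fun z => ?_)
  rw [MonoidHom.mem_ker, powMonoidHom_apply, ← ofAdd_nsmul, nsmul_eq_mul, ofAdd_eq_one]

/-- The number of solutions of a homogeneous linear system modulo `g`. -/
theorem IsSmithForm.card_solutions {p k : ℕ} {M : Matrix (Fin p) (Fin k) ℤ} {d : ℕ → ℕ}
    (hd : IsSmithForm M d) (g : ℕ) [NeZero g] :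
    (Finset.univ.filter fun y : Fin k → ZMod g => ∀ i, ∑ l, (M i l : ZMod g) * y l = 0).card =
      ∏ j ∈ Finset.Icc 1 k, Nat.gcd (d j) g := by
  classical
  obtain ⟨P, Q, hP, hQ, hD⟩ := hd.2.2.2
  set D := (Matrix.of fun (i : Fin p) (j : Fin k) =>
    if (i : ℕ) = (j : ℕ) then (d (i + 1) : ℤ) else 0) with hDdef
  let c := Int.castRingHom (ZMod g)
  have hPc : IsUnit (P.map c).det := by
    have := hP.map c; rwa [RingHom.map_det] at this
  have hQc : IsUnit (Q.map c).det := by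
    have := hQ.map c; rwa [RingHom.map_det] at this
  have hDc : P.map c * M.map c * Q.map c = D.map c := by
    rw [← hD, Matrix.map_mul, Matrix.map_mul]
  have hiff : ∀ z : Fin k → ZMod g,
      (M.map c).mulVec ((Q.map c).mulVec z) = 0 ↔ ∀ l : Fin k, (d (l + 1) : ZMod g) * z l = 0 := by
    intro z
    have h1 : (M.map c).mulVec ((Q.map c).mulVec z) = 0 ↔ (D.map c).mulVec z = 0 := by
      rw [← hDc, Matrix.mul_assoc, ← Matrix.mulVec_mulVec, ← Matrix.mulVec_mulVec]
      refine ⟨fun h => by rw [h, Matrix.mulVec_zero], fun h => ?_⟩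
      have := Matrix.mulVec_injective_of_isUnit ((Matrix.isUnit_iff_isUnit_det _).2 hPc)
      exact this (by rw [h, Matrix.mulVec_zero])
    have h2 : ∀ (i : Fin p) (l : Fin k), (i : ℕ) = l →
        (D.map c).mulVec z i = (d (l + 1) : ZMod g) * z l := by
      intro i l hil
      simp only [Matrix.mulVec, dotProduct]
      rw [Finset.sum_eq_single l]
      · simp [D, hil]
      · intro b _ hb
        have : (i : ℕ) ≠ b := fun h => hb (Fin.ext (by omega))
        simp [D, this]
      · simp
    rw [h1]
    constructor
    · intro h l
      by_cases hl : (l : ℕ) < p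
      · rw [← h2 ⟨l, hl⟩ l rfl, h]; rfl
      -- Coordinates beyond the number of rows are free: there `d = 0`, matching the factor `gcd(0,
      -- g) = g`.
      · rw [hd.2.2.1 _ (by omega)]; simp
    · intro h
      ext i
      by_cases hi : (i : ℕ) < k
      · rw [h2 i ⟨i, hi⟩ rfl, h]; rfl
      · simp only [Matrix.mulVec, dotProduct]
        refine Finset.sum_eq_zero fun l _ => ?_
        have : (i : ℕ) ≠ l := by omega
        simp [D, this]
  calc (Finset.univ.filter fun y : Fin k → ZMod g => ∀ i, ∑ l, (M i l : ZMod g) * y l = 0).card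
      = (Finset.univ.filter fun z : Fin k → ZMod g =>
          ∀ l : Fin k, (d (l + 1) : ZMod g) * z l = 0).card := by
        symm
        refine Finset.card_bij (fun z _ => (Q.map c).mulVec z) ?_ ?_ ?_
        · intro z hz
          simp only [Finset.mem_filter, Finset.mem_univ, true_and] at hz ⊢
          exact fun i => congrFun ((hiff z).2 hz) i
        · intro z _ z' _ h
          exact Matrix.mulVec_injective_of_isUnit ((Matrix.isUnit_iff_isUnit_det _).2 hQc) h
        · intro y hy
          simp only [Finset.mem_filter, Finset.mem_univ, true_and] at hy
          have hy' : (Q.map c).mulVec ((Q.map c)⁻¹.mulVec y) = y := by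
            rw [Matrix.mulVec_mulVec, Matrix.mul_nonsing_inv _ hQc, Matrix.one_mulVec]
          refine ⟨(Q.map c)⁻¹.mulVec y, ?_, hy'⟩
          simp only [Finset.mem_filter, Finset.mem_univ, true_and]
          rw [← hiff, hy']
          exact funext hy
    _ = (Fintype.piFinset fun l : Fin k =>
          Finset.univ.filter fun z : ZMod g => (d (l + 1) : ZMod g) * z = 0).card := by
        congr 1
        ext z
        simp
    _ = ∏ l : Fin k, Nat.gcd (d (l + 1)) g := by
        rw [Fintype.card_piFinset]
        exact Finset.prod_congr rfl fun l _ => card_mul_eq_zero g _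
    _ = ∏ j ∈ Finset.Icc 1 k, Nat.gcd (d j) g := by
        rw [Fin.prod_univ_eq_prod_range (fun l => Nat.gcd (d (l + 1)) g), Finset.range_eq_Ico,
          Finset.prod_Ico_add' (fun l => Nat.gcd (d l) g)]
        rfl

/-- If `d j ≠ 0`, divisibility makes `d 1, …, d j` all nonzero, so the leading `j × j` block of the
diagonal form is invertible and the rank is at least `j`. -/
theorem IsSmithForm.eq_zero_of_intRank_lt {p k : ℕ} {M : Matrix (Fin p) (Fin k) ℤ} {d : ℕ → ℕ}
    (hd : IsSmithForm M d) {j : ℕ} (hj : intRank M < j) : d j = 0 := by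
  classical
  by_contra hne
  have hjm : j ≤ min p k := by
    by_contra h; exact hne (hd.2.2.1 _ (by omega))
  obtain ⟨P, Q, hP, hQ, hD⟩ := hd.2.2.2
  set D := (Matrix.of fun (i : Fin p) (j : Fin k) =>
    if (i : ℕ) = (j : ℕ) then (d (i + 1) : ℤ) else 0) with hDdef
  let c := Int.castRingHom ℝ
  have h1 : (D.map c).rank ≤ intRank M := by
    rw [← hD, Matrix.map_mul, Matrix.map_mul]
    exact (Matrix.rank_mul_le_left _ _).trans (Matrix.rank_mul_le_right _ _)
  let S : Matrix (Fin j) (Fin j) ℝ := Matrix.diagonal fun i => (d (i + 1) : ℝ)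
  have hS : (D.map c).submatrix (Fin.castLE (by omega : j ≤ p)) (Fin.castLE (by omega : j ≤ k)) = S := by
    ext a b
    by_cases hab : a = b
    · simp [S, hab, D]
    · have : (a : ℕ) ≠ b := fun h => hab (Fin.ext h)
      simp [S, hab, D, this]
  have h2 : S.rank = j := by
    have : IsUnit S := by
      rw [Matrix.isUnit_iff_isUnit_det, Matrix.det_diagonal, isUnit_iff_ne_zero,
        Finset.prod_ne_zero_iff]
      intro i _ h
      have h0 : d (i + 1) = 0 := by exact_mod_cast h
      exact hne (Nat.eq_zero_of_zero_dvd (h0 ▸ hd.dvd_of_le (by omega)))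
    rw [Matrix.rank_of_isUnit _ this, Fintype.card_fin]
  have h3 := Matrix.rank_submatrix_le (D.map c) (Fin.castLE (by omega : j ≤ p)) (Fin.castLE (by omega : j ≤ k))
  rw [hS, h2] at h3
  omega

/-! ### Active elements and the sign-reversing involution -/

section ActiveElements

variable {E K V : Type*} [LinearOrder E] [Field K] [AddCommGroup V] [Module K V]

variable (K) in
/-- `e` is active over `J` if `u e` is spanned by the members of `J` smaller than `e`; in other
words, `J` contains a broken circuit obtained from a circuit with largest element `e`. -/
def IsActive (u : E → V) (J : Finset E) (e : E) : Prop :=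
  u e ∈ Submodule.span K (u '' {i | i ∈ J ∧ i < e})

theorem IsActive.mono {u : E → V} {J J' : Finset E} {e : E} (h : IsActive K u J e) (hJ : J ⊆ J') :
    IsActive K u J' e :=
  Submodule.span_mono (Set.image_mono (Set.ofPred_subset_ofPred.2 fun _ hi => ⟨hJ hi.1, hi.2⟩)) h

theorem isActive_insert_self {u : E → V} {J : Finset E} {e : E} :
    IsActive K u (insert e J) e ↔ IsActive K u J e := by
  have : {i | i ∈ insert e J ∧ i < e} = {i | i ∈ J ∧ i < e} := by
    ext i
    simp only [Set.mem_ofPred_eq, Finset.mem_insert]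
    exact ⟨fun h => ⟨h.1.resolve_left h.2.ne, h.2⟩, fun h => ⟨Or.inr h.1, h.2⟩⟩
  rw [IsActive, IsActive, this]

/-- An active `e` is already spanned by members of `J` below any `f > e`, so adding it does not
enlarge the span that decides whether `f` is active. -/
theorem IsActive.insert_iff {u : E → V} {J : Finset E} {e f : E} (h : IsActive K u J e)
    (hef : e ≤ f) : IsActive K u (insert e J) f ↔ IsActive K u J f := by
  rcases hef.eq_or_lt with rfl | hlt
  · exact isActive_insert_self
  have h1 : {i | i ∈ insert e J ∧ i < f} = insert e {i | i ∈ J ∧ i < f} := by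
    ext i
    simp only [Set.mem_ofPred_eq, Finset.mem_insert, Set.mem_insert_iff]
    refine ⟨fun h => h.1.imp_right fun h' => ⟨h', h.2⟩, ?_⟩
    rintro (rfl | h)
    · exact ⟨Or.inl rfl, hlt⟩
    · exact ⟨Or.inr h.1, h.2⟩
  have h2 : u e ∈ Submodule.span K (u '' {i | i ∈ J ∧ i < f}) :=
    Submodule.span_mono (Set.image_mono (Set.ofPred_subset_ofPred.2 fun _ hi => ⟨hi.1, hi.2.trans hlt⟩)) h
  rw [IsActive, h1, Set.image_insert_eq, Submodule.span_insert_eq_span h2, IsActive]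

/-- Remove `e` from `J` or add it. -/
def toggle (e : E) (J : Finset E) : Finset E := if e ∈ J then J.erase e else insert e J

theorem toggle_toggle (e : E) (J : Finset E) : toggle e (toggle e J) = J := by
  by_cases h : e ∈ J
  · simp [toggle, h, Finset.insert_erase h]
  · simp [toggle, h]

theorem toggle_subset {e : E} {J T : Finset E} (he : e ∈ T) (hJ : J ⊆ T) : toggle e J ⊆ T := by
  rw [toggle]; split_ifs
  · exact (Finset.erase_subset _ _).trans hJ
  · exact Finset.insert_subset he hJ

theorem neg_one_pow_card_toggle (e : E) (J : Finset E) :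
    (-1 : ℤ) ^ J.card + (-1) ^ (toggle e J).card = 0 := by
  rw [toggle]; split_ifs with h
  · rw [← Finset.card_erase_add_one h, pow_succ]; ring
  · rw [Finset.card_insert_of_notMem h, pow_succ]; ring

theorem IsActive.toggle_iff {u : E → V} {J : Finset E} {e f : E} (h : IsActive K u J e)
    (hef : e ≤ f) : IsActive K u (toggle e J) f ↔ IsActive K u J f := by
  rw [toggle]; split_ifs with hJ
  · rw [← Finset.insert_erase hJ, isActive_insert_self] at h
    rw [← h.insert_iff hef, Finset.insert_erase hJ]
  · exact h.insert_iff hef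

/-- Toggling the largest active element is a sign-reversing involution. -/
theorem sum_neg_one_pow_card_eq_sum_not_isActive (u : E → V) (T : Finset E)
    (P : Finset E → Prop) (hP : ∀ J ⊆ T, ∀ e ∈ T, u e ∈ Submodule.span K (u '' J) →
      (P (insert e J) ↔ P J)) [DecidablePred P]
    [DecidablePred fun J : Finset E => P J ∧ ∀ e ∈ T, ¬ IsActive K u J e] :
    ∑ J ∈ T.powerset with P J, (-1 : ℤ) ^ J.card =
      ∑ J ∈ T.powerset with (P J ∧ ∀ e ∈ T, ¬ IsActive K u J e), (-1 : ℤ) ^ J.card := by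
  classical
  let act : Finset E → Finset E := fun J => T.filter (IsActive K u J)
  have hPt : ∀ J ⊆ T, ∀ e ∈ T, IsActive K u J e → (P (toggle e J) ↔ P J) := by
    intro J hJ e he h
    rw [toggle]; split_ifs with heJ
    · rw [← Finset.insert_erase heJ, isActive_insert_self] at h
      rw [← hP (J.erase e) ((Finset.erase_subset _ _).trans hJ) e he
        (Submodule.span_mono (Set.image_mono fun _ hi => hi.1) h), Finset.insert_erase heJ]
    · exact hP J hJ e he (Submodule.span_mono (Set.image_mono fun _ hi => hi.1) h)
  -- Toggling the largest active element changes no activity at or above it, so the same element is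
  -- chosen again and the map is an involution.
  have hmax : ∀ (J : Finset E) (h : (act J).Nonempty)
      (h' : (act (toggle ((act J).max' h) J)).Nonempty),
      (act (toggle ((act J).max' h) J)).max' h' = (act J).max' h := by
    intro J h h'
    have hmem := Finset.mem_filter.1 ((act J).max'_mem h)
    refine le_antisymm (Finset.max'_le _ _ _ fun f hf => ?_) (Finset.le_max' _ _ ?_)
    · by_contra hlt
      have hf' := Finset.mem_filter.1 hf
      exact hlt (Finset.le_max' _ _ (Finset.mem_filter.2
        ⟨hf'.1, (hmem.2.toggle_iff (not_le.1 hlt).le).1 hf'.2⟩))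
    · exact Finset.mem_filter.2 ⟨hmem.1, (hmem.2.toggle_iff le_rfl).2 hmem.2⟩
  have hzero : ∑ J ∈ (T.powerset.filter P).filter (fun J => (act J).Nonempty),
      (-1 : ℤ) ^ J.card = 0 := by
    refine Finset.sum_involution
      (fun J hJ => toggle ((act J).max' (Finset.mem_filter.1 hJ).2) J) ?_ ?_ ?_ ?_
    · intro J hJ
      exact neg_one_pow_card_toggle _ _
    · intro J hJ _ heq
      have h1 := neg_one_pow_card_toggle ((act J).max' (Finset.mem_filter.1 hJ).2) J
      rw [heq] at h1
      rcases neg_one_pow_eq_or ℤ J.card with h2 | h2 <;> omega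
    · intro J hJ
      simp only [Finset.mem_filter, Finset.mem_powerset] at hJ ⊢
      have hmem := Finset.mem_filter.1 ((act J).max'_mem hJ.2)
      refine ⟨⟨toggle_subset hmem.1 hJ.1.1, (hPt J hJ.1.1 _ hmem.1 hmem.2).2 hJ.1.2⟩,
        (act J).max' hJ.2, Finset.mem_filter.2 ⟨hmem.1, ?_⟩⟩
      exact (hmem.2.toggle_iff le_rfl).2 hmem.2
    · intro J hJ
      rw [hmax, toggle_toggle]
  rw [← Finset.sum_filter_add_sum_filter_not _ (fun J => (act J).Nonempty), hzero, zero_add]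
  refine Finset.sum_congr ?_ fun _ _ => rfl
  ext J
  simp only [Finset.mem_filter, Finset.not_nonempty_iff_eq_empty, act, Finset.filter_eq_empty_iff,
    and_assoc]

/-- Built up in increasing order, `J` gains at each step a vector outside the span of its
predecessors. -/
theorem linearIndepOn_of_not_isActive {u : E → V} {J : Finset E}
    (h : ∀ e ∈ J, ¬ IsActive K u J e) : LinearIndepOn K u (J : Set E) := by
  classical
  induction J using Finset.induction_on_max with
  | empty => simp
  | insert a s hs ih =>
    have has : a ∉ (s : Set E) := fun ha => (hs a ha).false
    rw [Finset.coe_insert, linearIndepOn_insert has]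
    refine ⟨ih fun e he h' => h e (Finset.mem_insert_of_mem he)
      (h'.mono (Finset.subset_insert _ _)), fun ha => h a (Finset.mem_insert_self _ _) ?_⟩
    exact Submodule.span_mono (Set.image_mono (Set.subset_ofPred.2 fun i hi =>
      ⟨Finset.mem_insert_of_mem hi, hs i hi⟩)) ha

theorem finrank_span_image_eq_card {ι : Type*} {u : ι → V} {J : Finset ι}
    (h : LinearIndepOn K u (J : Set ι)) :
    Module.finrank K (Submodule.span K (u '' J)) = J.card := by
  have := finrank_span_eq_card (R := K) (b := fun i : (J : Set ι) => u i) h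
  rw [Set.image_eq_range, this]
  simp

/-- The sets surviving the involution are independent, so by `hPj` they all have size `j` and the
sign becomes constant. -/
theorem neg_one_pow_mul_sum_eq_card (u : E → V) (T : Finset E) (j : ℕ)
    (P : Finset E → Prop) (hP : ∀ J ⊆ T, ∀ e ∈ T, u e ∈ Submodule.span K (u '' J) →
      (P (insert e J) ↔ P J))
    (hPj : ∀ J, P J → LinearIndepOn K u (J : Set E) → J.card = j) [DecidablePred P]
    [DecidablePred fun J : Finset E => P J ∧ ∀ e ∈ T, ¬ IsActive K u J e] :
    (-1 : ℤ) ^ j * ∑ J ∈ T.powerset with P J, (-1 : ℤ) ^ J.card =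
      (T.powerset.filter fun J => P J ∧ ∀ e ∈ T, ¬ IsActive K u J e).card := by
  rw [sum_neg_one_pow_card_eq_sum_not_isActive u T P hP, Finset.mul_sum, Finset.card_eq_sum_ones,
    Nat.cast_sum]
  refine Finset.sum_congr rfl fun J hJ => ?_
  obtain ⟨hJT, hPJ, hJa⟩ := Finset.mem_filter.1 hJ
  rw [hPj J hPJ (linearIndepOn_of_not_isActive fun e he => hJa e (Finset.mem_powerset.1 hJT he)),
    ← mul_pow]
  simp

theorem sum_finrank_eq_nonneg (u : E → V) (T : Finset E) (j : ℕ) :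
    0 ≤ (-1 : ℤ) ^ j * ∑ J ∈ T.powerset.filter fun J : Finset E =>
      Module.finrank K (Submodule.span K (u '' (J : Set E))) = j, (-1 : ℤ) ^ J.card := by
  classical
  rw [neg_one_pow_mul_sum_eq_card (K := K) u T j
    (fun J => Module.finrank K (Submodule.span K (u '' (J : Set E))) = j)]
  · positivity
  · intro J _ e _ he
    rw [Finset.coe_insert, Set.image_insert_eq, Submodule.span_insert_eq_span he]
  · rintro J hJ hli
    rw [← hJ, finrank_span_image_eq_card hli]

/-- The greedy basis from the top: `e` is kept when `u e` is not spanned by larger elements. Every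
`u e` then lies in the span of the members of `J` at or above `e`. If `e` were active, it would also
lie in the span of those below `e`; independence makes these spans disjoint, forcing `u e = 0`. -/
theorem exists_basis_not_isActive [Fintype E] (u : E → V) (hu : ∀ e, u e ≠ 0) :
    ∃ J : Finset E, LinearIndepOn K u (J : Set E) ∧
      Submodule.span K (u '' J) = Submodule.span K (Set.range u) ∧ ∀ e, ¬ IsActive K u J e := by
  classical
  let J : Finset E := Finset.univ.filter fun e => u e ∉ Submodule.span K (u '' Set.Ioi e)
  have hJmem : ∀ e, e ∈ J ↔ u e ∉ Submodule.span K (u '' Set.Ioi e) := fun e => by simp [J]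
  have hli : LinearIndepOn K u (J : Set E) :=
    -- In the reversed order, activity refers to the members of `J` larger than `e`.
    linearIndepOn_of_not_isActive (E := Eᵒᵈ) (J := J) fun e he h => by
      refine (hJmem e).1 he (Submodule.span_mono ?_ h)
      rintro _ ⟨i, hi, rfl⟩
      exact ⟨i, hi.2, rfl⟩
  have hspan : ∀ e, u e ∈ Submodule.span K (u '' {i | i ∈ J ∧ e ≤ i}) := by
    intro e
    induction e using WellFoundedGT.induction with
    | ind e ih =>
      by_cases he : e ∈ J
      · exact Submodule.subset_span ⟨e, ⟨he, le_rfl⟩, rfl⟩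
      · rw [hJmem, not_not] at he
        refine Submodule.span_le.2 ?_ he
        rintro _ ⟨i, hi, rfl⟩
        exact Submodule.span_mono (Set.image_mono (Set.ofPred_subset_ofPred.2
          fun k hk => ⟨hk.1, (le_of_lt hi).trans hk.2⟩)) (ih i hi)
  refine ⟨J, hli, le_antisymm (Submodule.span_mono (Set.image_subset_range _ _))
    (Submodule.span_le.2 ?_), ?_⟩
  · rintro _ ⟨e, rfl⟩
    exact Submodule.span_mono (Set.image_mono fun i hi => hi.1) (hspan e)
  · intro e he
    have hd : Disjoint {i | i ∈ J ∧ i < e} {i | i ∈ J ∧ e ≤ i} :=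
      Set.disjoint_left.2 fun i hi hi' => hi'.2.not_gt hi.2
    have hdis := ((linearIndepOn_union_iff hd).1 (hli.mono (Set.union_subset
      (Set.ofPred_subset.2 fun i hi => hi.1) (Set.ofPred_subset.2 fun i hi => hi.1)))).2.2
    exact hu e (Submodule.disjoint_def.1 hdis _ he (hspan e))

end ActiveElements

/-! ### Real ranks, consistency and centrality -/

section Rank

variable {m n : ℕ} (A : Matrix (Fin m) (Fin n) ℤ) (v : Fin m → ℤ)

/-- The row `α_i` as a real vector. -/
def rowVec (i : Fin m) : Fin n → ℝ := fun k => (A i k : ℝ)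

/-- The augmented row `(α_i, v_i)` as a real vector. -/
def augVec (i : Fin m) : Fin (n + 1) → ℝ := Fin.snoc (rowVec A i) (v i : ℝ)

theorem image_orderEmbOfFin {β : Type*} (f : Fin m → β) (J : Finset (Fin m)) :
    Set.range (fun i => f (J.orderEmbOfFin rfl i)) = f '' J := by
  rw [← Finset.range_orderEmbOfFin J rfl, ← Set.range_comp]
  rfl

theorem rk_eq (J : Finset (Fin m)) :
    rk A J = Module.finrank ℝ (Submodule.span ℝ (rowVec A '' J)) := by
  rw [rk, intRank, Matrix.rank_eq_finrank_span_row, ← image_orderEmbOfFin]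
  rfl

theorem augRk_eq (J : Finset (Fin m)) :
    augRk A v J = Module.finrank ℝ (Submodule.span ℝ (augVec A v '' J)) := by
  have h : ((augRowsOf A v J).map (Int.cast : ℤ → ℝ)).row =
      fun i => augVec A v (J.orderEmbOfFin rfl i) := by
    ext i k
    refine Fin.lastCases ?_ (fun k => ?_) k <;>
      simp [Matrix.row, augRowsOf, rowsOf, augVec, rowVec]
  rw [augRk, intRank, Matrix.rank_eq_finrank_span_row, h, image_orderEmbOfFin]

theorem intRank_eq : intRank A = Module.finrank ℝ (Submodule.span ℝ (Set.range (rowVec A))) := by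
  rw [intRank, Matrix.rank_eq_finrank_span_row]
  rfl

theorem intRank_le_width {p k : ℕ} (M : Matrix (Fin p) (Fin k) ℤ) : intRank M ≤ k :=
  (Matrix.rank_le_width _)

theorem rk_le_width (J : Finset (Fin m)) : rk A J ≤ n := intRank_le_width _

theorem funLeft_augVec (i : Fin m) :
    LinearMap.funLeft ℝ ℝ Fin.castSucc (augVec A v i) = rowVec A i := by
  ext k
  simp [LinearMap.funLeft_apply, augVec]

theorem map_span_augVec (J : Set (Fin m)) :
    (Submodule.span ℝ (augVec A v '' J)).map (LinearMap.funLeft ℝ ℝ Fin.castSucc) =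
      Submodule.span ℝ (rowVec A '' J) := by
  rw [Submodule.map_span, ← Set.image_comp]
  congr 2
  exact funext fun i => funLeft_augVec A v i

variable {A v}

theorem isCentral_iff {J : Finset (Fin m)} :
    IsCentral A v J ↔ ∃ x : Fin n → ℝ, ∀ i ∈ J, rowVec A i ⬝ᵥ x = v i := by
  simp only [IsCentral, Set.Nonempty, Set.mem_iInter]
  rfl

theorem IsCentral.mono {J K : Finset (Fin m)} (h : IsCentral A v J) (hK : K ⊆ J) :
    IsCentral A v K := by
  rw [isCentral_iff] at h ⊢
  exact h.imp fun x hx i hi => hx i (hK hi)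

/-- The map is `w ↦ (w, w · x)` for a common point `x`. Through it, plain and augmented rows satisfy
the same linear relations on a central set. -/
theorem IsCentral.exists_lift {J : Finset (Fin m)} (h : IsCentral A v J) :
    ∃ L : (Fin n → ℝ) →ₗ[ℝ] (Fin (n + 1) → ℝ), Function.Injective L ∧
      ∀ i ∈ J, L (rowVec A i) = augVec A v i := by
  obtain ⟨x, hx⟩ := isCentral_iff.1 h
  refine ⟨⟨⟨fun w => Fin.snoc (α := fun _ => ℝ) w (w ⬝ᵥ x), ?_⟩, ?_⟩, ?_, ?_⟩
  · intro a b
    ext k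
    refine Fin.lastCases ?_ (fun k => ?_) k <;> simp [add_dotProduct]
  · intro a b
    ext k
    refine Fin.lastCases ?_ (fun k => ?_) k <;> simp [smul_dotProduct]
  · intro a b hab
    ext k
    have := congrFun hab k.castSucc
    simpa using this
  · intro i hi
    change Fin.snoc (α := fun _ => ℝ) (rowVec A i) (rowVec A i ⬝ᵥ x) = _
    rw [hx i hi, augVec]

theorem IsCentral.augVec_mem_span_iff {J : Finset (Fin m)} (h : IsCentral A v J) {i : Fin m}
    (hi : i ∈ J) {K : Set (Fin m)} (hK : K ⊆ J) :
    augVec A v i ∈ Submodule.span ℝ (augVec A v '' K) ↔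
      rowVec A i ∈ Submodule.span ℝ (rowVec A '' K) := by
  obtain ⟨L, hL, hLr⟩ := h.exists_lift
  have himg : augVec A v '' K = L '' (rowVec A '' K) := by
    rw [← Set.image_comp]
    exact Set.image_congr fun k hk => (hLr k (hK hk)).symm
  rw [himg, ← Submodule.map_span, ← hLr i hi]
  exact ⟨fun ⟨y, hy, he⟩ => hL he ▸ hy, Submodule.mem_map_of_mem⟩

/-- Equality of ranks means that forgetting the last coordinate is injective on the span of the
augmented rows. A left inverse followed by the last coordinate is a functional taking `α_i` to
`v_i`, that is, a common point. Conversely, the lift preserves dimension. -/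
theorem mem_consistentSets_iff {J : Finset (Fin m)} :
    J ∈ consistentSets A v ↔ IsCentral A v J := by
  rw [consistentSets, Finset.mem_filter, and_iff_right (Finset.mem_univ _), augRk_eq, rk_eq]
  constructor
  · intro h
    set S := Submodule.span ℝ (augVec A v '' J) with hS
    let f := (LinearMap.funLeft ℝ ℝ (Fin.castSucc (n := n))).domRestrict S
    have hker : LinearMap.ker f = ⊥ := by
      have h1 := f.finrank_range_add_finrank_ker
      rw [LinearMap.range_domRestrict, map_span_augVec, h] at h1
      exact Submodule.finrank_eq_zero.1 (by omega)
    obtain ⟨g, hg⟩ := f.exists_leftInverse_of_injective hker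
    let φ : (Fin n → ℝ) →ₗ[ℝ] ℝ := LinearMap.proj (Fin.last n) ∘ₗ S.subtype ∘ₗ g
    rw [isCentral_iff]
    refine ⟨fun k => φ (Pi.single k 1), fun i hi => ?_⟩
    have h2 : φ (rowVec A i) = v i := by
      have h3 : f ⟨augVec A v i, Submodule.subset_span ⟨i, hi, rfl⟩⟩ = rowVec A i :=
        funLeft_augVec A v i
      have h4 := LinearMap.congr_fun hg ⟨augVec A v i, Submodule.subset_span ⟨i, hi, rfl⟩⟩
      rw [LinearMap.comp_apply, h3] at h4
      simp [φ, h4, augVec]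
    rw [← h2, LinearMap.pi_apply_eq_sum_univ φ (rowVec A i)]
    simp [dotProduct]
    refine Finset.sum_congr rfl fun k _ => ?_
    congr 2
    ext l
    simp [Pi.single_apply, eq_comm]
  · intro h
    obtain ⟨L, hL, hLr⟩ := h.exists_lift
    have himg : augVec A v '' J = L '' (rowVec A '' J) := by
      rw [← Set.image_comp]
      exact Set.image_congr fun k hk => (hLr k hk).symm
    rw [himg, ← Submodule.map_span]
    exact LinearEquiv.finrank_eq (Submodule.equivMapOfInjective L hL _).symm

/-- Here `r̄(J) ≤ #J = r(J) ≤ r̄(J)`. -/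
theorem isCentral_of_linearIndepOn {J : Finset (Fin m)}
    (h : LinearIndepOn ℝ (rowVec A) (J : Set (Fin m))) : IsCentral A v J := by
  rw [← mem_consistentSets_iff, consistentSets, Finset.mem_filter, augRk_eq, rk_eq]
  refine ⟨Finset.mem_univ _, le_antisymm ?_ ?_⟩
  · rw [finrank_span_image_eq_card h]
    classical
    rw [← Finset.coe_image]
    exact (finrank_span_finset_le_card _).trans Finset.card_image_le
  · rw [← map_span_augVec A v]
    exact Submodule.finrank_map_le _ _

/-- Consistency and rank depend only on the span of the augmented rows. -/
theorem consistent_congr {J K : Finset (Fin m)}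
    (h : Submodule.span ℝ (augVec A v '' J) = Submodule.span ℝ (augVec A v '' K)) :
    rk A J = rk A K ∧ (J ∈ consistentSets A v ↔ K ∈ consistentSets A v) := by
  have h1 : rk A J = rk A K := by
    rw [rk_eq, rk_eq, ← map_span_augVec A v, ← map_span_augVec A v, h]
  refine ⟨h1, ?_⟩
  simp only [consistentSets, Finset.mem_filter, Finset.mem_univ, true_and]
  rw [h1, augRk_eq, augRk_eq, h]

theorem rk_eq_card_iff {J : Finset (Fin m)} :
    rk A J = J.card ↔ LinearIndepOn ℝ (rowVec A) (J : Set (Fin m)) := by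
  refine ⟨fun h => ?_, fun h => by rw [rk_eq, finrank_span_image_eq_card h]⟩
  rw [rk_eq, Set.image_eq_range] at h
  exact linearIndependent_iff_card_eq_finrank_span.2 (by simpa [Set.finrank] using h.symm)

end Rank

/-! ### Broken circuits and Whitney's theorem -/

section BrokenCircuits

variable {m n : ℕ} {A : Matrix (Fin m) (Fin n) ℤ} {v : Fin m → ℤ}

theorem IsCircuit.isActive {C : Finset (Fin m)} (hC : IsCircuit A v C) (h : C.Nonempty)
    {J : Finset (Fin m)} (hJ : C.erase (C.max' h) ⊆ J) :
    IsActive ℝ (augVec A v) J (C.max' h) := by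
  obtain ⟨hcen, hdep, hind⟩ := hC
  set e := C.max' h
  have heC : e ∈ C := C.max'_mem h
  have hli := rk_eq_card_iff.1 (hind _ (Finset.erase_ssubset heC))
  have h1 : rowVec A e ∈ Submodule.span ℝ (rowVec A '' (C.erase e : Finset (Fin m))) := by
    by_contra hne
    have h2 := (linearIndepOn_insert (by simp)).2 ⟨hli, hne⟩
    rw [← Finset.coe_insert, Finset.insert_erase heC, ← rk_eq_card_iff] at h2
    omega
  rw [← hcen.augVec_mem_span_iff heC (by simp)] at h1
  refine Submodule.span_mono (Set.image_mono (Set.subset_ofPred.2 fun i hi => ⟨hJ hi, ?_⟩)) h1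
  exact Finset.lt_max'_of_mem_erase_max' _ _ hi

/-- Take a minimal `K ⊆ J` below `e` whose rows span `α_e`. Minimality makes `K` independent and
each set `K' ∪ {e}` with `K' ⊂ K` independent, so `K ∪ {e}` is a circuit with largest element `e`.
It is central because adding a spanned augmented row preserves consistency. -/
theorem IsActive.exists_isBrokenCircuit {J : Finset (Fin m)} (hJ : IsCentral A v J) {e : Fin m}
    (h : IsActive ℝ (augVec A v) J e) : ∃ K, IsBrokenCircuit A v K ∧ K ⊆ J := by
  classical
  have hcen : IsCentral A v (insert e J) := by
    rw [← mem_consistentSets_iff] at hJ ⊢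
    refine (consistent_congr ?_).2.1 hJ
    rw [Finset.coe_insert, Set.image_insert_eq, Submodule.span_insert_eq_span]
    exact Submodule.span_mono (Set.image_mono (Set.ofPred_subset.2 fun i hi => hi.1)) h
  have hex : ∃ K : Finset (Fin m), K ⊆ J.filter (· < e) ∧
      rowVec A e ∈ Submodule.span ℝ (rowVec A '' (K : Set (Fin m))) := by
    refine ⟨J.filter (· < e), subset_rfl, ?_⟩
    rw [← hcen.augVec_mem_span_iff (Finset.mem_insert_self _ _)]
    · rw [Finset.coe_filter]; exact h
    · exact_mod_cast (Finset.filter_subset _ _).trans (Finset.subset_insert _ _)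
  obtain ⟨K, ⟨hKJ, hKe⟩, hmin⟩ : ∃ K, Minimal (fun K : Finset (Fin m) => K ⊆ J.filter (· < e) ∧
      rowVec A e ∈ Submodule.span ℝ (rowVec A '' (K : Set (Fin m)))) K := by
    obtain ⟨K₀, hK₀⟩ := hex
    obtain ⟨K, -, hK⟩ := exists_minimal_le_of_wellFoundedLT (fun K : Finset (Fin m) =>
      K ⊆ J.filter (· < e) ∧ rowVec A e ∈ Submodule.span ℝ (rowVec A '' (K : Set (Fin m)))) K₀ hK₀
    exact ⟨K, hK⟩
  have hlt : ∀ i ∈ K, i < e := fun i hi => (Finset.mem_filter.1 (hKJ hi)).2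
  have heK : e ∉ K := fun he => (hlt e he).false
  have hKsub : K ⊆ J := hKJ.trans (Finset.filter_subset _ _)
  -- no proper subset of `K` spans the row `e`
  have hproper : ∀ K' ⊂ K, rowVec A e ∉ Submodule.span ℝ (rowVec A '' (K' : Set (Fin m))) :=
    fun K' hK' hmem => hK'.2 (hmin ⟨hK'.1.trans hKJ, hmem⟩ hK'.1)
  have hKli : LinearIndepOn ℝ (rowVec A) (K : Set (Fin m)) := by
    rw [linearIndepOn_iff_notMem_span]
    intro i hi hmem
    refine hproper (K.erase i) (Finset.erase_ssubset hi) ?_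
    rw [Finset.coe_erase, ← Submodule.span_insert_eq_span hmem, ← Set.image_insert_eq,
      Set.insert_sdiff_singleton, Set.insert_eq_of_mem hi]
    exact hKe
  have hCne : (insert e K).Nonempty := ⟨e, Finset.mem_insert_self _ _⟩
  have hmax : (insert e K).max' hCne = e := by
    refine le_antisymm (Finset.max'_le _ _ _ fun i hi => ?_)
      (Finset.le_max' _ _ (Finset.mem_insert_self _ _))
    rcases Finset.mem_insert.1 hi with rfl | hi
    · exact le_rfl
    · exact (hlt i hi).le
  refine ⟨K, ⟨insert e K, ⟨hcen.mono (Finset.insert_subset_insert _ hKsub), ?_, ?_⟩, hCne, ?_⟩, hKsub⟩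
  · rw [Finset.card_insert_of_notMem heK, rk_eq, Finset.coe_insert, Set.image_insert_eq,
      Submodule.span_insert_eq_span hKe, finrank_span_image_eq_card hKli]
    omega
  · intro K' hK'
    rw [rk_eq_card_iff]
    by_cases he : e ∈ K'
    · have hss : K'.erase e ⊂ K := by
        rw [← Finset.insert_erase he] at hK'
        refine ⟨?_, fun h => hK'.2 (Finset.insert_subset_insert _ h)⟩
        intro i hi
        exact (Finset.mem_insert.1 (hK'.1 (Finset.mem_insert_of_mem hi))).resolve_left
          (Finset.ne_of_mem_erase hi)
      rw [← Finset.insert_erase he, Finset.coe_insert, linearIndepOn_insert (by simp)]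
      exact ⟨hKli.mono (by exact_mod_cast hss.1), hproper _ hss⟩
    · refine hKli.mono ?_
      exact_mod_cast fun i hi => (Finset.mem_insert.1 (hK'.1 hi)).resolve_left
        fun h => he (h ▸ hi)
  · rw [hmax, Finset.erase_insert heK]

theorem contains_no_brokenCircuit_iff {J : Finset (Fin m)} (hJ : IsCentral A v J) :
    (∀ K, IsBrokenCircuit A v K → ¬ K ⊆ J) ↔ ∀ e, ¬ IsActive ℝ (augVec A v) J e := by
  constructor
  · intro h e he
    obtain ⟨K, hK, hKJ⟩ := he.exists_isBrokenCircuit hJ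
    exact h K hK hKJ
  · rintro h K ⟨C, hC, hne, rfl⟩ hKJ
    exact h _ (hC.isActive hne hKJ)

/-- Whitney's broken circuit theorem. -/
theorem nbcNumber_eq (j : ℕ) : (nbcNumber A v j : ℤ) =
    (-1) ^ j * ∑ J ∈ consistentSets A v with rk A J = j, (-1 : ℤ) ^ J.card := by
  classical
  -- Activity is taken for augmented rows; consistency transfers the resulting size from `augRk` to
  -- `rk`.
  have hli : ∀ J : Finset (Fin m), LinearIndepOn ℝ (augVec A v) (J : Set (Fin m)) →
      J ∈ consistentSets A v → rk A J = J.card := by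
    intro J hJ hc
    rw [← (Finset.mem_filter.1 hc).2, augRk_eq, finrank_span_image_eq_card hJ]
  have h := neg_one_pow_mul_sum_eq_card (K := ℝ) (augVec A v) Finset.univ j
    (fun J => J ∈ consistentSets A v ∧ rk A J = j)
    (fun J _ e _ he => by
      have := consistent_congr (A := A) (v := v) (J := insert e J) (K := J) (by
        rw [Finset.coe_insert, Set.image_insert_eq, Submodule.span_insert_eq_span he])
      rw [this.1, this.2])
    (fun J hJ hJl => by rw [← hJ.2, hli J hJl hJ.1])
  have h1 : (Finset.univ.powerset.filter fun J => J ∈ consistentSets A v ∧ rk A J = j) =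
      (consistentSets A v).filter fun J => rk A J = j := by
    ext J; simp
  rw [h1] at h
  rw [h, nbcNumber]
  congr 2
  ext J
  simp only [Finset.mem_filter, Finset.mem_univ, true_and, Finset.powerset_univ, forall_const]
  constructor
  · rintro ⟨hj, hc, hb⟩
    have ha := (contains_no_brokenCircuit_iff hc).1 hb
    have hc' := mem_consistentSets_iff.2 hc
    exact ⟨⟨hc', (hli J (linearIndepOn_of_not_isActive fun e _ => ha e) hc').trans hj⟩, ha⟩
  · rintro ⟨⟨hc, hj⟩, ha⟩
    have hc' := mem_consistentSets_iff.1 hc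
    exact ⟨(hli J (linearIndepOn_of_not_isActive fun e _ => ha e) hc).symm.trans hj, hc',
      (contains_no_brokenCircuit_iff hc').2 ha⟩

theorem nbcNumber_pos (hA : ∀ i, A i ≠ 0) {j : ℕ} (hj : j ≤ intRank A) :
    0 < nbcNumber A v j := by
  classical
  obtain ⟨J, hli, hspan, hact⟩ := exists_basis_not_isActive (K := ℝ) (rowVec A) fun e h => hA e (by
    ext k
    have := congrFun h k
    simpa [rowVec] using this)
  rw [intRank_eq, ← hspan, finrank_span_image_eq_card hli] at hj
  obtain ⟨I, hIJ, hI⟩ := Finset.exists_subset_card_eq hj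
  have hc : IsCentral A v I := isCentral_of_linearIndepOn (hli.mono (by exact_mod_cast hIJ))
  refine Finset.card_pos.2 ⟨I, Finset.mem_filter.2 ⟨Finset.mem_univ _, hI, hc,
    (contains_no_brokenCircuit_iff hc).2 fun e he => hact e (IsActive.mono ?_ hIJ)⟩⟩
  -- Forgetting the last coordinate turns activity for augmented rows into activity for the rows of
  -- `A`, which the greedy basis excludes.
  have := Submodule.mem_map_of_mem (f := LinearMap.funLeft ℝ ℝ (Fin.castSucc (n := n))) he
  rwa [map_span_augVec, funLeft_augVec] at this

end BrokenCircuits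

theorem sum_eq_sum_castLE {n j : ℕ} (hj : j ≤ n) (f : Fin n → ℤ)
    (hf : ∀ l : Fin n, j ≤ (l : ℕ) → f l = 0) : ∑ l, f l = ∑ l : Fin j, f (Fin.castLE hj l) := by
  rw [← Finset.sum_subset (Finset.subset_univ (Finset.univ.map (Fin.castLEEmb hj))), Finset.sum_map]
  · rfl
  · intro l _ hl
    refine hf l ?_
    by_contra h
    exact hl (Finset.mem_map.2 ⟨⟨l, by omega⟩, Finset.mem_univ _, rfl⟩)

/-! ### The coefficients as alternating sums of gcd products -/

section Coefficients

variable {m n : ℕ} {A : Matrix (Fin m) (Fin n) ℤ} {v : Fin m → ℤ}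

theorem InColMod.exists_int {p k q : ℕ} {M : Matrix (Fin p) (Fin k) ℤ} {c : Fin p → ℤ}
    (h : InColMod q M c) : ∃ y : Fin k → ℤ, ∀ i, (q : ℤ) ∣ c i - ∑ l, M i l * y l := by
  obtain ⟨y, hy⟩ := (Submodule.mem_span_range_iff_exists_fun _).1 h
  choose z hz using fun l => ZMod.intCast_surjective (y l)
  refine ⟨z, fun i => ?_⟩
  rw [← ZMod.intCast_zmod_eq_zero_iff_dvd]
  have := congrFun hy i
  simp only [Finset.sum_apply, Pi.smul_apply, Matrix.transpose_apply, Matrix.map_apply,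
    smul_eq_mul] at this
  push_cast
  rw [← this, sub_eq_zero]
  exact Finset.sum_congr rfl fun l _ => by rw [hz, mul_comm]

/-- `A_J` is `[A_J, v_J]` times the matrix that drops the last column. Modulus `0` gives
divisibility over `ℤ`, since `gcd(0, d) = d`. -/
theorem augDFac_dvd_dFac (J : Finset (Fin m)) (j : ℕ) : augDFac A v J j ∣ dFac A J j := by
  have := (invFactor_spec (rowsOf A J)).gcd_dvd (invFactor_spec (augRowsOf A v J)) 0 1
    (Matrix.of fun a b => if a = Fin.castSucc b then 1 else 0) 0 (by
      ext i k
      simp [Matrix.mul_apply, augRowsOf]) j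
  rwa [Nat.gcd_zero_left] at this

/-- A solution `y` modulo `g` gives `[A_J, v_J] = A_J [I, y] + g [0, r]`. -/
theorem gcd_dFac_dvd_augDFac {J : Finset (Fin m)} {g : ℕ}
    (h : ∃ y : Fin n → ℤ, ∀ i, (g : ℤ) ∣
      v (J.orderEmbOfFin rfl i) - ∑ l, rowsOf A J i l * y l) (j : ℕ) :
    Nat.gcd g (dFac A J j) ∣ augDFac A v J j := by
  obtain ⟨y, hy⟩ := h
  choose r hr using hy
  refine (invFactor_spec (augRowsOf A v J)).gcd_dvd (invFactor_spec (rowsOf A J)) g 1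
    (Matrix.of fun a => Fin.snoc (fun b => if a = b then 1 else 0) (y a))
    (Matrix.of fun i => Fin.snoc (fun _ => 0) (r i)) ?_ j
  ext i k
  refine Fin.lastCases ?_ (fun k => ?_) k
  · simp [Matrix.mul_apply, augRowsOf, ← hr]
  · simp [Matrix.mul_apply, augRowsOf]

theorem dFac_dvd_lcmPeriod {J : Finset (Fin m)} (hJ : J ∈ consistentSets A v) {j : ℕ}
    (hj : j ≤ rk A J) : dFac A J j ∣ lcmPeriod A v :=
  ((invFactor_spec (rowsOf A J)).dvd_of_le hj).trans
    (Finset.dvd_lcm (f := fun J => dFac A J (rk A J)) hJ)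

theorem gcd_dFac_eq {J : Finset (Fin m)} (hJ : J ∈ consistentSets A v) {j : ℕ}
    (hj : j ≤ rk A J) (a : ℕ) :
    Nat.gcd (dFac A J j) a = Nat.gcd (dFac A J j) (Nat.gcd a (lcmPeriod A v)) := by
  rw [Nat.gcd_comm a, ← Nat.gcd_assoc, Nat.gcd_eq_left (dFac_dvd_lcmPeriod hJ hj)]

/-- The modular solvability of the system over `J` gives the formula for `d̃_J`. -/
theorem dTilde_eq {J : Finset (Fin m)} (hJ : J ∈ consistentSets A v) {a : ℕ}
    (h : ∃ y : Fin n → ℤ, ∀ i, (Nat.gcd a (lcmPeriod A v) : ℤ) ∣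
      v (J.orderEmbOfFin rfl i) - ∑ l, rowsOf A J i l * y l) :
    dTilde A v J a =
      ∏ j ∈ Finset.Icc 1 (rk A J), Nat.gcd (dFac A J j) (Nat.gcd a (lcmPeriod A v)) := by
  have hr := (Finset.mem_filter.1 hJ).2
  rw [dTilde, if_pos]
  · exact Finset.prod_congr rfl fun j hj => gcd_dFac_eq hJ (Finset.mem_Icc.1 hj).2 a
  intro j hj
  rw [hr, Finset.mem_Icc] at hj
  -- For the nontrivial divisibility, `d_{J,j} ∣ ρ_C` allows `a` to be replaced by `gcd(a, ρ_C)`,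
  -- modulo which the system is solvable.
  refine Nat.dvd_antisymm (Nat.dvd_gcd (Nat.gcd_dvd_left _ _) ?_)
    (Nat.gcd_dvd_gcd_of_dvd_right _ (augDFac_dvd_dFac J j))
  rw [Nat.gcd_comm, gcd_dFac_eq hJ hj.2, Nat.gcd_comm]
  exact gcd_dFac_dvd_augDFac h j

theorem gammaCoeff_eq_betaCoeff {j : ℕ} (hj : j ≤ n) (a : ℕ) :
    gammaCoeff A v j a = betaCoeff A v j a := by
  rw [gammaCoeff, betaCoeff, constituent, Polynomial.finsetSum_coeff, Finset.sum_filter]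
  congr 1
  refine Finset.sum_congr rfl fun J _ => ?_
  rw [Polynomial.coeff_C_mul_X_pow]
  have := rk_le_width A J
  exact if_congr (by omega) rfl rfl

variable (A v) in
/-- The alternating sum of the numbers `∏ gcd(d_{J,i}, g)` over the consistent sets of rank `j`. -/
noncomputable def gcdSum (j g : ℕ) : ℤ :=
  (-1) ^ j * ∑ J ∈ consistentSets A v with rk A J = j,
    (-1) ^ J.card * ((∏ i ∈ Finset.Icc 1 j, Nat.gcd (dFac A J i) g : ℕ) : ℤ)

theorem betaCoeff_eq_gcdSum {a : ℕ} (h : ∀ J ∈ consistentSets A v, ∃ y : Fin n → ℤ, ∀ i,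
      (Nat.gcd a (lcmPeriod A v) : ℤ) ∣
        v (J.orderEmbOfFin rfl i) - ∑ l, rowsOf A J i l * y l) (j : ℕ) :
    betaCoeff A v j a = gcdSum A v j (Nat.gcd a (lcmPeriod A v)) := by
  rw [betaCoeff, gcdSum]
  congr 1
  refine Finset.sum_congr rfl fun J hJ => ?_
  obtain ⟨hJ, hj⟩ := Finset.mem_filter.1 hJ
  rw [dTilde_eq hJ (h J hJ), hj]

theorem gcdSum_one (j : ℕ) : gcdSum A v j 1 = nbcNumber A v j := by
  simp [gcdSum, nbcNumber_eq]

end Coefficients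

/-! ### Monotonicity under divisibility of the modulus -/

section Monotone

variable {m n : ℕ} (A : Matrix (Fin m) (Fin n) ℤ) (v : Fin m → ℤ)

theorem forall_orderEmbOfFin {J : Finset (Fin m)} {p : Fin m → Prop} :
    (∀ i, p (J.orderEmbOfFin rfl i)) ↔ ∀ i ∈ J, p i := by
  have h : Set.range (J.orderEmbOfFin rfl) = (J : Set (Fin m)) := Finset.range_orderEmbOfFin J rfl
  rw [← Set.forall_mem_range (p := p), h]
  rfl

/-- The rows indexed by a set of rank `j` can be written in `j` coordinates; this preserves the
invariant factors. -/
theorem exists_reduced_matrix (F : Finset (Fin m)) :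
    ∃ B : Matrix (Fin m) (Fin (rk A F)) ℤ, ∀ J ⊆ F, ∀ i, dFac A J i = dFac B J i := by
  have hsm := invFactor_spec (rowsOf A F)
  obtain ⟨P, Q, hP, hQ, hD⟩ := hsm.2.2.2
  have hjn := rk_le_width A F
  -- The unimodular `Q` diagonalizing `A_F` makes the columns past the rank vanish on all rows of
  -- `F`.
  have hzero : ∀ i ∈ F, ∀ l : Fin n, rk A F ≤ (l : ℕ) → (A * Q) i l = 0 := by
    rw [← forall_orderEmbOfFin]
    intro i l hl
    have h1 : rowsOf A F * Q = P⁻¹ * (P * rowsOf A F * Q) := by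
      rw [Matrix.mul_assoc P, Matrix.nonsing_inv_mul_cancel_left _ _ hP]
    have h2 : (A * Q) (F.orderEmbOfFin rfl i) l = (rowsOf A F * Q) i l := rfl
    rw [h2, h1, hD, Matrix.mul_apply]
    refine Finset.sum_eq_zero fun x _ => ?_
    rw [Matrix.of_apply]
    split_ifs with hx
    · rw [hsm.eq_zero_of_intRank_lt (j := x + 1)]
      · simp
      · rw [hx]; exact Nat.lt_succ_of_le hl
    · simp
  -- `B` consists of the remaining columns of `A Q`. For `J ⊆ F`, `B_J` is a right multiple of `A_J`
  -- and conversely, so their invariant factors divide each other.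
  refine ⟨(A * Q).submatrix id (Fin.castLE hjn), fun J hJ i => Nat.dvd_antisymm ?_ ?_⟩
  · have := (invFactor_spec (rowsOf ((A * Q).submatrix id (Fin.castLE hjn)) J)).gcd_dvd
      (invFactor_spec (rowsOf A J)) 0 1 (Q.submatrix id (Fin.castLE hjn)) 0 (by
        rw [smul_zero, add_zero, Matrix.one_mul]; rfl) i
    rwa [Nat.gcd_zero_left] at this
  · have := (invFactor_spec (rowsOf A J)).gcd_dvd
      (invFactor_spec (rowsOf ((A * Q).submatrix id (Fin.castLE hjn)) J)) 0 1
      (Q⁻¹.submatrix (Fin.castLE hjn) id) 0 (by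
        rw [smul_zero, add_zero, Matrix.one_mul]
        ext a b
        have h1 : A = A * Q * Q⁻¹ := (Matrix.mul_nonsing_inv_cancel_right _ _ hQ).symm
        have h2 : rowsOf A J a b = (A * Q * Q⁻¹) (J.orderEmbOfFin rfl a) b := by
          rw [← h1]; rfl
        rw [h2, Matrix.mul_apply, sum_eq_sum_castLE hjn _ fun l hl => by
          rw [hzero _ (hJ (Finset.orderEmbOfFin_mem _ _ _)) l hl, zero_mul]]
        rfl) i
    rwa [Nat.gcd_zero_left] at this

theorem card_kernel_eq {j : ℕ} (B : Matrix (Fin m) (Fin j) ℤ) (J : Finset (Fin m)) (g : ℕ)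
    [NeZero g] :
    (Finset.univ.filter fun y : Fin j → ZMod g => ∀ i ∈ J, ∑ l, (B i l : ZMod g) * y l = 0).card =
      ∏ i ∈ Finset.Icc 1 j, Nat.gcd (dFac B J i) g := by
  simp only [dFac]
  rw [← (invFactor_spec (rowsOf B J)).card_solutions g]
  congr 1
  ext y
  simp only [Finset.mem_filter, Finset.mem_univ, true_and]
  exact (forall_orderEmbOfFin (p := fun i => ∑ l, (B i l : ZMod g) * y l = 0)).symm

/-- The embedding of `ℤ/p` into `ℤ/q` for `p ∣ q`. -/
theorem exists_zmod_embedding {p q : ℕ} [NeZero q] (h : p ∣ q) :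
    ∃ f : ZMod p →+ ZMod q, Function.Injective f := by
  obtain ⟨c, rfl⟩ := h
  have hc : c ≠ 0 := fun h => NeZero.ne (p * c) (by simp [h])
  -- The embedding sends `1` to `c = q / p`.
  have h0 : ((zmultiplesHom (ZMod (p * c))) (c : ZMod (p * c))) (p : ℤ) = 0 := by
    simp only [zmultiplesHom_apply, natCast_zsmul, nsmul_eq_mul]
    exact_mod_cast ZMod.natCast_self (p * c)
  refine ⟨ZMod.lift p ⟨_, h0⟩, (ZMod.lift_injective _).2 fun z hz => ?_⟩
  have h1 : ((z * c : ℤ) : ZMod (p * c)) = 0 := by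
    simpa [zmultiplesHom_apply, zsmul_eq_mul] using hz
  rw [ZMod.intCast_zmod_eq_zero_iff_dvd] at h1 ⊢
  push_cast at h1
  exact Int.dvd_of_mul_dvd_mul_right (by exact_mod_cast hc) h1

/-- Each product is replaced by the number of points killed by the rows in `J`, and the sums over
`J` and `y` are interchanged. -/
theorem sum_powerset_gcd_eq {j : ℕ} (F : Finset (Fin m)) (B : Matrix (Fin m) (Fin j) ℤ)
    (hB : ∀ J ⊆ F, ∀ i, dFac A J i = dFac B J i) (g : ℕ) [NeZero g] :
    (-1) ^ j * ∑ J ∈ F.powerset with rk A J = j,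
        (-1) ^ J.card * ((∏ i ∈ Finset.Icc 1 j, Nat.gcd (dFac A J i) g : ℕ) : ℤ) =
      ∑ y : Fin j → ZMod g, (-1) ^ j *
        ∑ J ∈ (F.filter fun i => ∑ l, (B i l : ZMod g) * y l = 0).powerset with rk A J = j,
          (-1) ^ J.card := by
  classical
  rw [← Finset.mul_sum]
  congr 1
  have h1 : ∀ J ∈ F.powerset.filter fun J => rk A J = j,
      (-1) ^ J.card * ((∏ i ∈ Finset.Icc 1 j, Nat.gcd (dFac A J i) g : ℕ) : ℤ) =
        ∑ y : Fin j → ZMod g,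
          if ∀ i ∈ J, ∑ l, (B i l : ZMod g) * y l = 0 then (-1) ^ J.card else 0 := by
    intro J hJ
    have hJF := Finset.mem_powerset.1 (Finset.mem_filter.1 hJ).1
    simp only [hB J hJF]
    rw [← card_kernel_eq B J g, ← Finset.sum_filter, Finset.sum_const, nsmul_eq_mul, mul_comm]
  rw [Finset.sum_congr rfl h1, Finset.sum_comm]
  refine Finset.sum_congr rfl fun y _ => ?_
  rw [← Finset.sum_filter]
  refine Finset.sum_congr ?_ fun _ _ => rfl
  ext J
  simp only [Finset.mem_filter, Finset.mem_powerset, Finset.subset_iff]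
  grind

theorem sum_powerset_gcd_le (F : Finset (Fin m)) {p q : ℕ} [NeZero p] [NeZero q] (hpq : p ∣ q) :
    (-1) ^ rk A F * ∑ J ∈ F.powerset with rk A J = rk A F,
        (-1) ^ J.card * ((∏ i ∈ Finset.Icc 1 (rk A F), Nat.gcd (dFac A J i) p : ℕ) : ℤ) ≤
      (-1) ^ rk A F * ∑ J ∈ F.powerset with rk A J = rk A F,
        (-1) ^ J.card * ((∏ i ∈ Finset.Icc 1 (rk A F), Nat.gcd (dFac A J i) q : ℕ) : ℤ) := by
  classical
  obtain ⟨B, hB⟩ := exists_reduced_matrix A F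
  obtain ⟨f, hf⟩ := exists_zmod_embedding hpq
  rw [sum_powerset_gcd_eq A F B hB, sum_powerset_gcd_eq A F B hB]
  have hinj : Function.Injective fun y : Fin (rk A F) → ZMod p => f ∘ y := hf.comp_left
  -- The equations have integer coefficients, so an injective additive map preserves and reflects
  -- them.
  have hiff : ∀ (y : Fin (rk A F) → ZMod p) (i : Fin m),
      ∑ l, (B i l : ZMod p) * y l = 0 ↔ ∑ l, (B i l : ZMod q) * (f ∘ y) l = 0 := by
    intro y i
    rw [← map_eq_zero_iff f hf, map_sum]
    simp only [← zsmul_eq_mul, map_zsmul, Function.comp_apply]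
  simp only [hiff]
  let G : (Fin (rk A F) → ZMod q) → ℤ := fun z =>
    (-1) ^ rk A F * ∑ J ∈ (F.filter fun i => ∑ l, (B i l : ZMod q) * z l = 0).powerset with
      rk A J = rk A F, (-1) ^ J.card
  refine (Finset.sum_map Finset.univ ⟨_, hinj⟩ G).symm.le.trans
    (Finset.sum_le_sum_of_subset_of_nonneg (Finset.subset_univ _) fun z _ _ => ?_)
  simp only [G]
  simp only [rk_eq A]
  exact sum_finrank_eq_nonneg _ _ _

theorem gcdSum_le (j : ℕ) {p q : ℕ} [NeZero p] [NeZero q] (hpq : p ∣ q) :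
    gcdSum A v j p ≤ gcdSum A v j q := by
  classical
  -- The closure in the matroid of augmented rows. For a consistent `J` of rank `j`, the fibre of
  -- `cl` through `J` is the set of all rank-`j` subsets of the flat `cl J`.
  let cl : Finset (Fin m) → Finset (Fin m) := fun J =>
    Finset.univ.filter fun e => augVec A v e ∈ Submodule.span ℝ (augVec A v '' J)
  have hsub : ∀ J, J ⊆ cl J := fun J i hi =>
    Finset.mem_filter.2 ⟨Finset.mem_univ _, Submodule.subset_span ⟨i, hi, rfl⟩⟩
  have hspan : ∀ J, Submodule.span ℝ (augVec A v '' (cl J : Finset (Fin m))) =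
      Submodule.span ℝ (augVec A v '' J) := by
    intro J
    refine le_antisymm (Submodule.span_le.2 ?_)
      (Submodule.span_mono (Set.image_mono (by exact_mod_cast hsub J)))
    rintro _ ⟨i, hi, rfl⟩
    exact (Finset.mem_filter.1 hi).2
  have hcl : ∀ J K : Finset (Fin m), Submodule.span ℝ (augVec A v '' J) =
      Submodule.span ℝ (augVec A v '' K) → cl J = cl K := fun J K h => by simp only [cl, h]
  set s := (consistentSets A v).filter fun J => rk A J = j with hs
  have hfib : ∀ F ∈ s.image cl, rk A F = j ∧
      s.filter (fun J => cl J = F) = F.powerset.filter fun J => rk A J = j := by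
    intro F hF
    obtain ⟨J, hJ, rfl⟩ := Finset.mem_image.1 hF
    rw [hs, Finset.mem_filter] at hJ
    obtain ⟨h1, h2⟩ := consistent_congr (hspan J)
    have hcons := h2.2 hJ.1
    refine ⟨h1.trans hJ.2, ?_⟩
    ext K
    simp only [hs, Finset.mem_filter, Finset.mem_powerset]
    constructor
    · rintro ⟨⟨-, hr⟩, hK⟩
      exact ⟨hK ▸ hsub K, hr⟩
    · rintro ⟨hK, hr⟩
      have hKc : K ∈ consistentSets A v :=
        mem_consistentSets_iff.2 ((mem_consistentSets_iff.1 hcons).mono hK)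
      refine ⟨⟨hKc, hr⟩, hcl _ _ ?_⟩
      -- Both sets are consistent, so their augmented ranks also equal `j`, and the inclusion of
      -- spans is an equality.
      rw [← hspan J]
      refine Submodule.eq_of_le_of_finrank_eq
        (Submodule.span_mono (Set.image_mono (by exact_mod_cast hK))) ?_
      rw [← augRk_eq, ← augRk_eq, (Finset.mem_filter.1 hKc).2, (Finset.mem_filter.1 hcons).2, hr,
        h1, hJ.2]
  have hsum : ∀ g, gcdSum A v j g = ∑ F ∈ s.image cl, (-1) ^ j *
      ∑ J ∈ F.powerset with rk A J = j,
        (-1) ^ J.card * ((∏ i ∈ Finset.Icc 1 j, Nat.gcd (dFac A J i) g : ℕ) : ℤ) := by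
    intro g
    rw [gcdSum, ← hs, ← Finset.sum_fiberwise_of_maps_to (t := s.image cl) (g := cl)
      fun J hJ => Finset.mem_image_of_mem _ hJ, Finset.mul_sum]
    exact Finset.sum_congr rfl fun F hF => by rw [(hfib F hF).2]
  rw [hsum, hsum]
  refine Finset.sum_le_sum fun F hF => ?_
  obtain ⟨h, -⟩ := hfib F hF
  subst h
  exact sum_powerset_gcd_le A F hpq

end Monotone

/-! ### The chain of inequalities -/

/-- Comparison of coefficients under modular solvability of all consistent subsystems. -/
theorem coeff_comparison {m n : ℕ} {A : Matrix (Fin m) (Fin n) ℤ} {v : Fin m → ℤ}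
    (hA : ∀ i, A i ≠ 0) {q a b : ℕ} (ha : 1 ≤ a) (hb : 1 ≤ b)
    (hab : Nat.gcd a (lcmPeriod A v) ∣ Nat.gcd b (lcmPeriod A v))
    (hbq : Nat.gcd b (lcmPeriod A v) = Nat.gcd q (lcmPeriod A v))
    (hsol : ∀ J ∈ consistentSets A v, ∃ y : Fin n → ℤ, ∀ i,
      (Nat.gcd q (lcmPeriod A v) : ℤ) ∣
        v (J.orderEmbOfFin rfl i) - ∑ l, rowsOf A J i l * y l)
    {j : ℕ} (hj : j ≤ intRank A) :
    0 < nbcNumber A v j ∧ (nbcNumber A v j : ℤ) = gammaCoeff A v j 1 ∧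
      gammaCoeff A v j 1 ≤ gammaCoeff A v j a ∧ gammaCoeff A v j a ≤ gammaCoeff A v j b ∧
      gammaCoeff A v j b = betaCoeff A v j q := by
  have hjn : j ≤ n := hj.trans (intRank_le_width A)
  have hq := betaCoeff_eq_gcdSum hsol j
  have hb' : betaCoeff A v j b = gcdSum A v j (Nat.gcd b (lcmPeriod A v)) :=
    betaCoeff_eq_gcdSum (hbq ▸ hsol) j
  have ha' : betaCoeff A v j a = gcdSum A v j (Nat.gcd a (lcmPeriod A v)) := by
    refine betaCoeff_eq_gcdSum (fun J hJ => (hsol J hJ).imp fun y hy i => ?_) j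
    exact (Int.natCast_dvd_natCast.2 (hbq ▸ hab)).trans (hy i)
  -- Modulo `1` every system is solvable, so no condition is needed for the first constituent.
  have h1 : betaCoeff A v j 1 = gcdSum A v j 1 := by
    rw [betaCoeff_eq_gcdSum (fun J _ => ⟨0, fun i => by simp⟩) j, Nat.gcd_one_left]
  have : NeZero (Nat.gcd a (lcmPeriod A v)) := ⟨(Nat.gcd_pos_of_pos_left _ ha).ne'⟩
  have : NeZero (Nat.gcd b (lcmPeriod A v)) := ⟨(Nat.gcd_pos_of_pos_left _ hb).ne'⟩
  simp only [gammaCoeff_eq_betaCoeff hjn, hq, hb', ha', h1]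
  exact ⟨nbcNumber_pos hA hj, (gcdSum_one j).symm, gcdSum_le A v j (one_dvd _),
    gcdSum_le A v j hab, by rw [hbq]⟩

end IntegralArrangement

theorem mainTheorem8 {m n : ℕ} (A : Matrix (Fin m) (Fin n) ℤ) (v : Fin m → ℤ)
    (hA : ∀ i, A i ≠ 0) :
    (∀ q a b : ℕ, IntegralArrangement.qZero A v < q →
      1 ≤ a → a ≤ IntegralArrangement.lcmPeriod A v →
      1 ≤ b → b ≤ IntegralArrangement.lcmPeriod A v →
      Nat.gcd a (IntegralArrangement.lcmPeriod A v) ∣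
        Nat.gcd b (IntegralArrangement.lcmPeriod A v) →
      Nat.gcd b (IntegralArrangement.lcmPeriod A v) =
        Nat.gcd q (IntegralArrangement.lcmPeriod A v) →
      IntegralArrangement.CombEquiv A v
        (Nat.gcd a (IntegralArrangement.lcmPeriod A v))
        (Nat.gcd b (IntegralArrangement.lcmPeriod A v)) →
      IntegralArrangement.SolvableMod A v q →
      ∀ j : ℕ, j ≤ IntegralArrangement.intRank A →
        0 < IntegralArrangement.nbcNumber A v j ∧
        (IntegralArrangement.nbcNumber A v j : ℤ) = IntegralArrangement.gammaCoeff A v j 1 ∧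
        IntegralArrangement.gammaCoeff A v j 1 ≤ IntegralArrangement.gammaCoeff A v j a ∧
        IntegralArrangement.gammaCoeff A v j a ≤ IntegralArrangement.gammaCoeff A v j b ∧
        IntegralArrangement.gammaCoeff A v j b = IntegralArrangement.betaCoeff A v j q) ∧
    (v = 0 → ∀ q a b : ℕ, 0 < q →
      1 ≤ a → a ≤ IntegralArrangement.lcmPeriod A v →
      1 ≤ b → b ≤ IntegralArrangement.lcmPeriod A v →
      Nat.gcd a (IntegralArrangement.lcmPeriod A v) ∣
        Nat.gcd b (IntegralArrangement.lcmPeriod A v) →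
      Nat.gcd b (IntegralArrangement.lcmPeriod A v) =
        Nat.gcd q (IntegralArrangement.lcmPeriod A v) →
      ∀ j : ℕ, j ≤ IntegralArrangement.intRank A →
        0 < IntegralArrangement.nbcNumber A v j ∧
        (IntegralArrangement.nbcNumber A v j : ℤ) = IntegralArrangement.gammaCoeff A v j 1 ∧
        IntegralArrangement.gammaCoeff A v j 1 ≤ IntegralArrangement.gammaCoeff A v j a ∧
        IntegralArrangement.gammaCoeff A v j a ≤ IntegralArrangement.gammaCoeff A v j b ∧
        IntegralArrangement.gammaCoeff A v j b = IntegralArrangement.betaCoeff A v j q) := by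
  refine ⟨fun q a b _ ha _ hb _ hab hbq _ hsol j hj => ?_, ?_⟩
  · refine IntegralArrangement.coeff_comparison hA ha hb hab hbq (fun J hJ => ?_) hj
    exact (hsol J hJ).exists_int.imp fun y hy i =>
      (Int.natCast_dvd_natCast.2 (Nat.gcd_dvd_left _ _)).trans (hy i)
  · rintro rfl q a b _ ha _ hb _ hab hbq j hj
    exact IntegralArrangement.coeff_comparison hA ha hb hab hbq
      (fun J _ => ⟨0, fun i => by simp⟩) hj
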